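/- **Setting.** A transmitter at $\mathbf a\in\mathbb R^2$ emits $\sqrt E\,s(t)$, with $E>0$ and $s:\mathbb R\to\mathbb C$. Receiver $n$, at $\mathbf a_n\in\mathbb R^2$, has noise variance $\sigma_n^2>0$ and estimates $\hat\tau_n\in\mathbb R$, $\hat\alpha_n\in\mathbb C$. Let $c>0$ be the speed of light, $T_s>0$ the sampling period, $T_d\in\mathbb R$, $K\in\mathbb N$, $\hat{\boldsymbol\theta}\in\mathbb R^2$, and let $\Omega$ be a fixed finite set of selected receivers. Put $\mathcal K_n=\{k\in\mathbb Z:\ \hat\tau_n-T_d/2\le kT_s\le\hat\tau_n+T_d/2\}$ and $K_n=|\mathcal K_n|$. For $a\in\mathbb C^{\mathcal K_n}$ let $[a]\in\mathbb R^{2K_n}$ list the real parts and then the imaginary parts of $a$. With $$\mathrm{CRLB}_{\hat\tau_n}=\Big(\tfrac{2E}{\sigma_n^2}|\hat\alpha_n|^2\sum_{k=1}^K|s'(kT_s-\hat\tau_n)|^2\Big)^{-1},\qquad \mathrm{CRLB}_{\hat\alpha_n}=\Big(\tfrac{2E}{\sigma_n^2}\sum_{k=1}^K|s(kT_s-\hat\tau_n)|^2\Big)^{-1},$$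 $p_n=[\hat\alpha_n s'(kT_s-\hat\tau_n)]$, $q_{n1}=[s(kT_s-\hat\tau_n)]$, $q_{n2}=[\mathrm i\,s(kT_s-\hat\tau_n)]$, let $$\mathbf Q_{\mathbf r_n}=E\,\mathrm{CRLB}_{\hat\tau_n}p_np_n^T+\tfrac E2\mathrm{CRLB}_{\hat\alpha_n}(q_{n1}q_{n1}^T+q_{n2}q_{n2}^T)+\tfrac12\sigma_n^2\mathbf I=\mathbf U_n\,\mathrm{diag}(\gamma_{n1},\dots,\gamma_{n(2K_n)})\,\mathbf U_n^T$$ be an eigenvalue decomposition with $\mathbf U_n$ orthogonal. Let $\mathbf s_n(\boldsymbol\theta)=[\sqrt E\,\hat\alpha_n s(kT_s-\tau_n(\boldsymbol\theta))]$ with $\tau_n(\boldsymbol\theta)=(\|\mathbf a-\boldsymbol\theta\|+\|\mathbf a_n-\boldsymbol\theta\|)/c$, and let $\mathbf D_n=\partial\mathbf s_n/\partial\boldsymbol\theta\in\mathbb R^{2\times 2K_n}$ at $\hat{\boldsymbol\theta}$. **Relaxed problem.** The variables are $\boldsymbol x=(\{X_{nj}\}_{n\in\Omega,\,j\le 2K_n},W,\mathrm{vec}(\mathbf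 M))$, with Euclidean norm and domain $\mathcal X=\{X_{nj}\ge0,\ W>0,\ \mathbf M\in\mathbb R^{2\times2}\text{ symmetric}\}$. Let $$\mathbf J(\boldsymbol x)=\sum_{n\in\Omega}\mathbf D_n\Big(\tfrac12\sigma_n^2\mathbf I+\mathbf U_n\,\mathrm{diag}_j\big(\gamma_{nj}/2^{2X_{nj}-1}\big)\mathbf U_n^T\Big)^{-1}\mathbf D_n^T=\sum_{n\in\Omega}\mathbf D_n\mathbf U_n\,\mathrm{diag}_j\big(y_{nj}(X_{nj})\big)(\mathbf D_n\mathbf U_n)^T,$$ where $y_{nj}(X)=\dfrac{2^{2X-1}}{\gamma_{nj}+2^{2X-2}\sigma_n^2}$, let $\mathbf G(\boldsymbol x)=\begin{bmatrix}\mathbf M&\mathbf I_2\\ \mathbf I_2&\mathbf J(\boldsymbol x)\end{bmatrix}$, and for $\emptyset\ne\mathcal S\subseteq\Omega$ let $C_{\mathcal S}=\log_2\big(1+\sum_{n\in\mathcal S}P_ng_n/N_0\big)$ with $P_n,g_n,N_0>0$. For a given $\epsilon\in\mathbb R$ the relaxed bit-allocation problem is to minimise $f_0(\boldsymbol x)=W$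 over $\boldsymbol x\in\mathcal X$ subject to $f_i(\boldsymbol x)\le0$, where the $f_i$, $i=1,\dots,m$, are: $f_1=-\lambda_{\min}(\mathbf G(\boldsymbol x))$; $f_2=\mathrm{tr}(\mathbf M)-\epsilon$; and, for each non-empty $\mathcal S\subseteq\Omega$, the capacity constraint function, written either (for all $\mathcal S$) as $\sum_{n\in\mathcal S}\sum_jX_{nj}/W-C_{\mathcal S}$ or (for all $\mathcal S$) as $\sum_{n\in\mathcal S}\sum_jX_{nj}-W\,C_{\mathcal S}$. **Algorithm.** Let $\mu>0$ and let $(\beta^t)_{t\ge0}$ be decreasing with $\beta^t\to0$ and $\sum_t\beta^t=\infty$. Given $\boldsymbol x^t$, let $\bar{\mathbf G}^t(\boldsymbol x)$ be $\mathbf G(\boldsymbol x)$ with each $y_{nj}(X_{nj})$ replaced by its tangent $y_{nj}(X^t_{nj})+y_{nj}'(X^t_{nj})(X_{nj}-X^t_{nj})$, and put $\bar f_1^t(\boldsymbol x)=-\lambda_{\min}(\bar{\mathbf G}^t(\boldsymbol x))+\mu\|\boldsymbol x-\boldsymbol x^t\|^2$ and $\bar f_i^t(\boldsymbol x)=f_i(\boldsymbol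 x)+\mu\|\boldsymbol x-\boldsymbol x^t\|^2$ for $i\ne1$. Let $\boldsymbol x^0$ be feasible for the relaxed problem, and for every $t\ge 0$ let $\boldsymbol x^{t+1}$ be a minimiser of $\bar f_0^t$ over $\{\boldsymbol x\in\mathcal X:\ \bar f_i^t(\boldsymbol x)\le0\ (1\le i\le m),\ \|\boldsymbol x-\boldsymbol x^t\|^2\le(\beta^t)^2\}$. **Theorem 1.** Let $\boldsymbol x^*\in\mathcal X$ be the limit of a subsequence $(\boldsymbol x^{t_k})_k$ of the iterates, and suppose that Slater's condition holds for it: the limits $\hat f_i(\boldsymbol x)=\lim_k\bar f_i^{t_k}(\boldsymbol x)$ ($\boldsymbol x\in\mathcal X$, $1\le i\le m$) exist and there is $\boldsymbol x\in\mathrm{relint}\,\mathcal X$ with $\hat f_i(\boldsymbol x)<0$ for all $i=1,\dots,m$. Then $\boldsymbol x^*$ is a KKT (stationary) point of the relaxed problem: it is feasible, and there are multipliers $\lambda_1,\dots,\lambda_m\ge0$ with $\lambda_if_i(\boldsymbol x^*)=0$ for all $i$ and $$0\in\partial f_0(\boldsymbol x^*)+\sum_{i=1}^m\lambda_i\,\partial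 f_i(\boldsymbol x^*)+N_{\mathcal X}(\boldsymbol x^*).$$ Here $N_{\mathcal X}$ is the normal cone of the convex set $\mathcal X$, and $\partial$ is the Fréchet subdifferential, so that $\partial f_i(\boldsymbol x^*)=\{\nabla f_i(\boldsymbol x^*)\}$ wherever $f_i$ is differentiable (only $f_1$ may fail to be); for the purpose of $\partial f_1$, $\lambda_{\min}$ is extended to non-symmetric matrices as the minimum of the Rayleigh quotient. -/

import Mathlib

open Filter Topology
open scoped Matrix InnerProductSpace

noncomputable section

namespace MCSCA

/-! ### Constrained minimisation: solutions, Fréchet subgradients, KKT points -/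

section Optimization

variable {E I : Type*} [NormedAddCommGroup E] [InnerProductSpace ℝ E]

/-- `x` is feasible for `min f₀` over `𝒳` subject to `f i ≤ 0` for all `i`. -/
def IsFeasible (𝒳 : Set E) (f : I → E → ℝ) (x : E) : Prop :=
  x ∈ 𝒳 ∧ ∀ i, f i x ≤ 0

/-- `x` is a (global) solution of `min f₀` over `𝒳` subject to `f i ≤ 0` for all `i`. -/
def IsSolution (𝒳 : Set E) (f₀ : E → ℝ) (f : I → E → ℝ) (x : E) : Prop :=
  IsFeasible 𝒳 f x ∧ ∀ z, IsFeasible 𝒳 f z → f₀ x ≤ f₀ z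

/-- The Fréchet subdifferential of `f` at `x`: all `ξ` with
`f z ≥ f x + ⟪ξ, z - x⟫ - o(‖z - x‖)` as `z → x`.
It is `{∇ f x}` when `f` is differentiable at `x`, and the usual subdifferential when `f` is
convex. -/
def subdiff (f : E → ℝ) (x : E) : Set E :=
  {ξ | ∀ ε > 0, ∀ᶠ z in 𝓝 x, f x + ⟪ξ, z - x⟫_ℝ - ε * ‖z - x‖ ≤ f z}

/-- The normal cone to the convex set `𝒳` at `x`. -/
def normalCone (𝒳 : Set E) (x : E) : Set E :=
  {ζ | ∀ z ∈ 𝒳, ⟪ζ, z - x⟫_ℝ ≤ 0}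

/-- `x` is a KKT (stationary) point of `min f₀` over `𝒳` subject to `f i ≤ 0` for all `i`. -/
def IsKKT [Fintype I] (𝒳 : Set E) (f₀ : E → ℝ) (f : I → E → ℝ) (x : E) : Prop :=
  IsFeasible 𝒳 f x ∧
  ∃ (lam : I → ℝ) (ξ₀ : E) (ξ : I → E) (ζ : E),
    (∀ i, 0 ≤ lam i) ∧ (∀ i, lam i * f i x = 0) ∧
    ξ₀ ∈ subdiff f₀ x ∧ (∀ i, ξ i ∈ subdiff (f i) x) ∧ ζ ∈ normalCone 𝒳 x ∧
    ξ₀ + ∑ i, lam i • ξ i + ζ = 0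

end Optimization

/-! ### Smallest eigenvalue -/

/-- The smallest eigenvalue of a symmetric matrix, as the minimum of its Rayleigh quotient;
see `isLeast_minEig`. -/
def minEig {n : Type*} [Fintype n] (A : Matrix n n ℝ) : ℝ :=
  ⨅ v : {v : n → ℝ // v ≠ 0}, (v.1 ⬝ᵥ (A *ᵥ v.1)) / (v.1 ⬝ᵥ v.1)

/-- For a symmetric matrix, `minEig` is the smallest eigenvalue. -/
theorem isLeast_minEig {n : Type*} [Fintype n] [DecidableEq n] [Nonempty n] (A : Matrix n n ℝ)
    (hA : A.IsSymm) :
    IsLeast {a : ℝ | Module.End.HasEigenvalue (Matrix.toLin' A) a} (minEig A) := by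
  have hT : (Matrix.toEuclideanLin A).IsSymmetric :=
    Matrix.isSymmetric_toEuclideanLin_iff.mpr (by simpa [Matrix.IsHermitian, Matrix.IsSymm] using hA)
  have hq : ∀ v : n → ℝ, inner ℝ (Matrix.toEuclideanLin A (WithLp.toLp 2 v)) (WithLp.toLp 2 v)
      / ‖(WithLp.toLp 2 v : EuclideanSpace ℝ n)‖ ^ 2 = (v ⬝ᵥ (A *ᵥ v)) / (v ⬝ᵥ v) := by
    intro v
    rw [← real_inner_self_eq_norm_sq, EuclideanSpace.inner_eq_star_dotProduct,
      EuclideanSpace.inner_eq_star_dotProduct]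
    simp
  have hmin : minEig A = ⨅ x : {x : EuclideanSpace ℝ n // x ≠ 0},
      RCLike.re (inner ℝ (Matrix.toEuclideanLin A x.1) x.1) / ‖x.1‖ ^ 2 := by
    unfold minEig
    refine Equiv.iInf_congr ((WithLp.linearEquiv 2 ℝ (n → ℝ)).symm.toEquiv.subtypeEquiv ?_) ?_
    · intro a; simp
    · rintro ⟨v, hv⟩
      exact hq v
  have key : ∀ a : ℝ, Module.End.HasEigenvalue (Matrix.toLin' A) a ↔
      Module.End.HasEigenvalue (Matrix.toEuclideanLin A) a := by
    intro a
    rw [Module.End.hasEigenvalue_iff_mem_spectrum, Module.End.hasEigenvalue_iff_mem_spectrum,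
      Matrix.spectrum_toLin', Matrix.spectrum_toLpLin]
  constructor
  · show Module.End.HasEigenvalue _ _
    rw [key, hmin]
    exact hT.hasEigenvalue_iInf_of_finiteDimensional
  · intro a ha
    obtain ⟨v, hv⟩ := Module.End.HasEigenvalue.exists_hasEigenvector ha
    have hv0 : v ≠ 0 := hv.2
    have hAv : A *ᵥ v = a • v := by simpa using hv.apply_eq_smul
    have hvv : v ⬝ᵥ v ≠ 0 := by simpa using hv0
    have hbdd : BddBelow (Set.range fun v : {v : n → ℝ // v ≠ 0} =>
        (v.1 ⬝ᵥ (A *ᵥ v.1)) / (v.1 ⬝ᵥ v.1)) := by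
      let L := LinearMap.toContinuousLinearMap (Matrix.toEuclideanLin A)
      refine ⟨-‖L‖, ?_⟩
      rintro _ ⟨⟨w, hw⟩, rfl⟩
      have hw' : (WithLp.toLp 2 w : EuclideanSpace ℝ n) ≠ 0 := by simpa using hw
      have hpos : 0 < ‖(WithLp.toLp 2 w : EuclideanSpace ℝ n)‖ ^ 2 := by positivity
      show -‖L‖ ≤ (w ⬝ᵥ (A *ᵥ w)) / (w ⬝ᵥ w)
      rw [← hq w, le_div_iff₀ hpos]
      have h1 := abs_real_inner_le_norm (L (WithLp.toLp 2 w)) (WithLp.toLp 2 w)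
      have h2 := L.le_opNorm (WithLp.toLp 2 w)
      have h3 := (abs_le.mp h1).1
      have h4 : inner ℝ (L (WithLp.toLp 2 w)) (WithLp.toLp 2 w)
        = inner ℝ (Matrix.toEuclideanLin A (WithLp.toLp 2 w)) (WithLp.toLp 2 w) := rfl
      rw [← h4]
      nlinarith [norm_nonneg (WithLp.toLp 2 w : EuclideanSpace ℝ n)]
    refine (ciInf_le hbdd ⟨v, hv0⟩).trans (le_of_eq ?_)
    show (v ⬝ᵥ (A *ᵥ v)) / (v ⬝ᵥ v) = a
    rw [hAv, dotProduct_smul, smul_eq_mul, mul_div_assoc, div_self hvv, mul_one]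

/-! ### The sensing scenario -/

/-- The data of the cooperative sensing system; `ι` is the set of all receivers. -/
structure Scenario (ι : Type*) where
  /-- transmitted power -/
  E : ℝ
  /-- waveform -/
  s : ℝ → ℂ
  /-- speed of light -/
  c : ℝ
  /-- sampling period -/
  Ts : ℝ
  /-- length of the interval of transmitted samples -/
  Td : ℝ
  /-- number of samples used for the local estimates -/
  K : ℕ
  /-- position of the transmitter -/
  tx : EuclideanSpace ℝ (Fin 2)
  /-- positions of the receivers -/
  rx : ι → EuclideanSpace ℝ (Fin 2)
  /-- noise variances `σₙ²` -/
  σ2 : ι → ℝ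
  /-- estimated delays -/
  τhat : ι → ℝ
  /-- estimated effective reflecting coefficients -/
  αhat : ι → ℂ
  /-- location at which the Fisher information matrix is evaluated -/
  θhat : EuclideanSpace ℝ (Fin 2)
  /-- selected receivers -/
  Ω : Finset ι
  /-- transmit powers of the receivers -/
  P : ι → ℝ
  /-- channel gains to the fusion center -/
  g : ι → ℝ
  /-- noise power at the fusion center -/
  N₀ : ℝ
  /-- bound on the Cramér-Rao lower bound -/
  ε : ℝ
  E_pos : 0 < E
  c_pos : 0 < c
  Ts_pos : 0 < Ts
  σ2_pos : ∀ n, 0 < σ2 n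
  P_pos : ∀ n, 0 < P n
  g_pos : ∀ n, 0 < g n
  N₀_pos : 0 < N₀

namespace Scenario

variable {ι : Type*} (D : Scenario ι)

/-- The sample indices `{k ∈ ℤ | τ̂ₙ - T_d/2 ≤ k T_s ≤ τ̂ₙ + T_d/2}` (recall `T_s > 0`). -/
def samples (n : ι) : Finset ℤ :=
  Finset.Icc ⌈(D.τhat n - D.Td / 2) / D.Ts⌉ ⌊(D.τhat n + D.Td / 2) / D.Ts⌋

/-- Index set of the `2Kₙ` real samples: real parts, then imaginary parts. -/
abbrev Idx (n : ι) : Type := D.samples n ⊕ D.samples n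

/-- The real vector of the real parts and then the imaginary parts of a complex sample vector. -/
def realify (n : ι) (a : ℤ → ℂ) : D.Idx n → ℝ :=
  Sum.elim (fun k => (a k).re) (fun k => (a k).im)

/-- Cramér-Rao lower bound of the delay. -/
def crlbτ (n : ι) : ℝ :=
  1 / (2 * D.E / D.σ2 n * ‖D.αhat n‖ ^ 2 *
    ∑ k ∈ Finset.Icc 1 D.K, ‖deriv D.s (k * D.Ts - D.τhat n)‖ ^ 2)

/-- Cramér-Rao lower bound of the effective reflecting coefficient. -/
def crlbα (n : ι) : ℝ :=
  1 / (2 * D.E / D.σ2 n * ∑ k ∈ Finset.Icc 1 D.K, ‖D.s (k * D.Ts - D.τhat n)‖ ^ 2)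

def pvec (n : ι) : D.Idx n → ℝ :=
  D.realify n fun k => D.αhat n * deriv D.s (k * D.Ts - D.τhat n)

def qvec₁ (n : ι) : D.Idx n → ℝ :=
  D.realify n fun k => D.s (k * D.Ts - D.τhat n)

/-- Multiplying by the imaginary unit turns `(Re s, Im s)` into `(-Im s, Re s)`. -/
def qvec₂ (n : ι) : D.Idx n → ℝ :=
  D.realify n fun k => Complex.I * D.s (k * D.Ts - D.τhat n)

/-- Covariance matrix of the (linearised) vector of real samples at receiver `n`. -/
def Qr (n : ι) : Matrix (D.Idx n) (D.Idx n) ℝ :=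
  (D.E * D.crlbτ n) • Matrix.vecMulVec (D.pvec n) (D.pvec n)
    + (D.E * (1 / 2 * D.crlbα n)) • Matrix.vecMulVec (D.qvec₁ n) (D.qvec₁ n)
    + (D.E * (1 / 2 * D.crlbα n)) • Matrix.vecMulVec (D.qvec₂ n) (D.qvec₂ n)
    + (1 / 2 * D.σ2 n) • (1 : Matrix (D.Idx n) (D.Idx n) ℝ)

/-- Delay at receiver `n` of the echo of a target at `θ`. -/
def delay (n : ι) (θ : EuclideanSpace ℝ (Fin 2)) : ℝ :=
  (dist D.tx θ + dist (D.rx n) θ) / D.c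

/-- The noiseless real sample vector of receiver `n` for a target at `θ`. -/
def signal (n : ι) (θ : EuclideanSpace ℝ (Fin 2)) : D.Idx n → ℝ :=
  D.realify n fun k => Real.sqrt D.E * (D.αhat n * D.s (k * D.Ts - D.delay n θ))

/-- The `2 × 2Kₙ` matrix `∂sₙ/∂θ` at `θ̂`. -/
def jac (n : ι) : Matrix (Fin 2) (D.Idx n) ℝ :=
  Matrix.of fun i j =>
    fderiv ℝ (fun θ => D.signal n θ j) D.θhat (EuclideanSpace.single i (1 : ℝ))

end Scenario

/-- Eigenvalue decompositions `Q = U diag(γ) Uᵀ` of the covariance matrices of a scenario. -/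
structure KLT {ι : Type*} (D : Scenario ι) where
  U : (n : ι) → Matrix (D.Idx n) (D.Idx n) ℝ
  γ : (n : ι) → D.Idx n → ℝ
  orthogonal : ∀ n, U n ∈ Matrix.orthogonalGroup (D.Idx n) ℝ
  decomp : ∀ n, D.Qr n = U n * Matrix.diagonal (γ n) * (U n)ᵀ

/-! ### The relaxed bit-allocation problem -/

/-- Index set of the coordinates of `x = [{X_{nj}}, W, vec(M)]`. -/
abbrev Coord {ι : Type*} (D : Scenario ι) : Type _ :=
  ((n : D.Ω) × D.Idx n) ⊕ Unit ⊕ (Fin 2 × Fin 2)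

/-- The space of the variables `x = [{X_{nj}}, W, vec(M)]`, with the Euclidean norm. -/
abbrev Var {ι : Type*} (D : Scenario ι) : Type _ := EuclideanSpace ℝ (Coord D)

/-- The two ways of writing the capacity constraint of a set `S` of receivers as `f ≤ 0`:
`X(S)/W - C_S ≤ 0`, or, multiplied by `W > 0`, `X(S) - W C_S ≤ 0`. -/
inductive CapacityForm
  | ratio
  | linear

/-- Index set of the constraints: the matrix inequality, the trace constraint, and one
capacity constraint for every non-empty set of selected receivers. -/
abbrev Con {ι : Type*} (D : Scenario ι) : Type _ :=
  Unit ⊕ Unit ⊕ {S : Finset D.Ω // S.Nonempty}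

section Problem

variable {ι : Type*} {D : Scenario ι}

/-- The number of bits `X_{nj}`. -/
def bits (x : Var D) (n : D.Ω) (j : D.Idx n) : ℝ := x (Sum.inl ⟨n, j⟩)

/-- The number of channel uses `W`. -/
def uses (x : Var D) : ℝ := x (Sum.inr (Sum.inl ()))

/-- The auxiliary matrix `M`. -/
def aux (x : Var D) : Matrix (Fin 2) (Fin 2) ℝ :=
  Matrix.of fun i k => x (Sum.inr (Sum.inr (i, k)))

variable (D) in
/-- The domain `𝒳`: `X_{nj} ≥ 0`, `W > 0`, `M` symmetric. -/
def domain : Set (Var D) :=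
  {x | (∀ n j, 0 ≤ bits x n j) ∧ 0 < uses x ∧ (aux x).IsSymm}

/-- Covariance matrix `Qₙ = Uₙ diag(η) Uₙᵀ` of the quantization error at receiver `n`, where
`η_{nj} = γ_{nj} / 2^(2 X_{nj} - 1)`. -/
def quantCov (T : KLT D) (x : Var D) (n : D.Ω) : Matrix (D.Idx n) (D.Idx n) ℝ :=
  T.U n * Matrix.diagonal (fun j => T.γ n j / (2 : ℝ) ^ (2 * bits x n j - 1)) * (T.U n)ᵀ

/-- The Fisher information matrix `J(θ̂)` as a function of the bit allocation. -/
def fisher (T : KLT D) (x : Var D) : Matrix (Fin 2) (Fin 2) ℝ :=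
  ∑ n : D.Ω, D.jac n *
    ((1 / 2 * D.σ2 n) • (1 : Matrix (D.Idx n) (D.Idx n) ℝ) + quantCov T x n)⁻¹ * (D.jac n)ᵀ

/-- `y_n(X) = 2^(2X-1) / (γ_{nj} + 2^(2X-2) σₙ²)`. -/
def yfun (T : KLT D) (n : D.Ω) (j : D.Idx n) (X : ℝ) : ℝ :=
  (2 : ℝ) ^ (2 * X - 1) / (T.γ n j + (2 : ℝ) ^ (2 * X - 2) * D.σ2 n)

/-- The tangent of `y_n` at the current point `Xt`. -/
def tangent (T : KLT D) (n : D.Ω) (j : D.Idx n) (Xt X : ℝ) : ℝ :=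
  (X - Xt) * deriv (yfun T n j) Xt + yfun T n j Xt

/-- The surrogate Fisher information matrix at the current point `xt`: in
`J = ∑ₙ (∂sₙ Uₙ) diag(y_n(X_{nj})) (∂sₙ Uₙ)ᵀ`, every `y_n` is replaced by its tangent. -/
def fisherSurr (T : KLT D) (xt x : Var D) : Matrix (Fin 2) (Fin 2) ℝ :=
  ∑ n : D.Ω, (D.jac n * T.U n) *
    Matrix.diagonal (fun j => tangent T n j (bits xt n j) (bits x n j)) * (D.jac n * T.U n)ᵀ

/-- The block matrix `[M, I; I, J]`. -/
def blockMat (M J : Matrix (Fin 2) (Fin 2) ℝ) : Matrix (Fin 2 ⊕ Fin 2) (Fin 2 ⊕ Fin 2) ℝ :=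
  Matrix.fromBlocks M 1 1 J

variable (D) in
/-- The capacity `log₂(1 + ∑_{n ∈ S} Pₙ gₙ / N₀)`, in bits per channel use. -/
def capacity (S : Finset D.Ω) : ℝ :=
  Real.logb 2 (1 + (∑ n ∈ S, D.P n * D.g n) / D.N₀)

/-- The capacity constraint function of a set `S` of receivers. -/
def capacityFun (F : CapacityForm) (S : Finset D.Ω) (x : Var D) : ℝ :=
  match F with
  | .ratio => (∑ n ∈ S, (∑ j, bits x n j) / uses x) - capacity D S
  | .linear => (∑ n ∈ S, ∑ j, bits x n j) - uses x * capacity D S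

/-- The constraint functions of the relaxed problem `min W` over `domain D` subject to
`-λ_min(G) ≤ 0`, `tr M - ε ≤ 0` and the capacity constraints. -/
def con (T : KLT D) (F : CapacityForm) : Con D → Var D → ℝ
  | .inl _, x => -minEig (blockMat (aux x) (fisher T x))
  | .inr (.inl _), x => (aux x).trace - D.ε
  | .inr (.inr S), x => capacityFun F S.1 x

/-- The surrogate objective at the current point `xt`. -/
def objSurr (μ : ℝ) (xt x : Var D) : ℝ := uses x + μ * ‖x - xt‖ ^ 2

/-- The surrogate constraint functions at the current point `xt`. -/
def conSurr (T : KLT D) (F : CapacityForm) (μ : ℝ) (xt : Var D) : Con D → Var D → ℝ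
  | .inl _, x => -minEig (blockMat (aux x) (fisherSurr T xt x)) + μ * ‖x - xt‖ ^ 2
  | .inr i, x => con T F (.inr i) x + μ * ‖x - xt‖ ^ 2

/-- `x` is a sequence of MCSCA iterates: it starts at a feasible point of the relaxed problem, and
`x (t+1)` solves the surrogate problem at `x t` with the trust region `‖z - x t‖² ≤ (β t)²`. -/
def IsMCSCA (T : KLT D) (F : CapacityForm) (μ : ℝ) (β : ℕ → ℝ) (x : ℕ → Var D) : Prop :=
  IsFeasible (domain D) (con T F) (x 0) ∧
  ∀ t, IsSolution (domain D ∩ {z | ‖z - x t‖ ^ 2 ≤ β t ^ 2})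
    (objSurr μ (x t)) (conSurr T F μ (x t)) (x (t + 1))

/-- Slater's condition for the iterates `x` along a subsequence `φ`: the surrogate constraint
functions converge pointwise on the domain, and their limits are simultaneously negative at some
point of the relative interior of the domain. -/
def Slater (T : KLT D) (F : CapacityForm) (μ : ℝ) (x : ℕ → Var D) (φ : ℕ → ℕ) : Prop :=
  ∃ flim : Con D → Var D → ℝ,
    (∀ i, ∀ z ∈ domain D,
      Tendsto (fun k => conSurr T F μ (x (φ k)) i z) atTop (𝓝 (flim i z))) ∧
    ∃ z ∈ intrinsicInterior ℝ (domain D), ∀ i, flim i z < 0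

end Problem

end MCSCA

end

/-! The tangent of `yfun` is accurate to second order, so a step of length at most β violates the
matrix constraint by only O(β²), and the other constraints hold at every iterate. Under Slater's
condition a feasible point that is critical (`IsCritical`) is a KKT point, by separation
(`isKKT_of_isCritical`). It remains to show that the limit point y is critical; this part does not
use Slater's condition.

If y is not critical, then near y each step lowers W by a multiple of β as soon as the violation is
O(β) (`IsMCSCA.exists_local_descent`). Hence the merit function W + κ · violation drops by a
multiple of β throughout a ball around y (`merit_step`). As Σβ diverges, the iterates leave the ball
and lose a fixed amount of merit on the way (`exists_merit_decrease`). This is not yet a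
contradiction: away from y, W may rise by β in a step, so it could climb back.

The return is blocked by a level w just below W(y) that contains no feasible critical point. By
compactness, descent is uniform near that level, so eventually W cannot cross it upwards
(`IsMCSCA.exists_uses_le_of_level`). Such levels exist because the critical values form a null set
(`volume_criticalValues_eq_zero`).

For this last fact the nonsmooth λ_min must go. Eliminating M by a Schur complement leaves the
analytic constraint tr J − ε det J ≤ 0. Its problem needs no constraint qualification, since extra
bits always improve accuracy. Writing multipliers as squares turns the KKT points into critical
points of one analytic function, to which Sard's theorem applies. -/

namespace MCSCA

/-! ### Sard's theorem for real-valued analytic functions. -/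

section Sard

open MeasureTheory Set
open scoped ContDiff NNReal ENNReal

/-- If the derivatives of `f` of order `1, …, N` vanish at `x`, then `f` is constant up to order
`N + 1` around `x`. -/
theorem norm_sub_le_of_iteratedFDeriv_eq_zero {E F : Type*} [NormedAddCommGroup E]
    [NormedSpace ℝ E] [NormedAddCommGroup F] [NormedSpace ℝ F] {f : E → F} {N : ℕ} {B : Set E}
    {K : ℝ} (hB : Convex ℝ B) (hf : ∀ y ∈ B, ContDiffAt ℝ ω f y)
    (hK : ∀ y ∈ B, ‖iteratedFDeriv ℝ (N + 1) f y‖ ≤ K) {x y : E} (hx : x ∈ B) (hy : y ∈ B)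
    (h0 : ∀ j, 1 ≤ j → j ≤ N → iteratedFDeriv ℝ j f x = 0) :
    ‖f y - f x‖ ≤ K * ‖y - x‖ ^ (N + 1) := by
  have hK0 : 0 ≤ K := (norm_nonneg _).trans (hK x hx)
  have hd : ∀ m : ℕ, ∀ z ∈ B, DifferentiableAt ℝ (iteratedFDeriv ℝ m f) z := fun m z hz =>
    ((hf z hz).iteratedFDeriv_right (m := ω) (i := m) (by simp)).differentiableAt (by simp)
  -- The mean value inequality on the segment from x to z trades one order of differentiation for
  -- one power of ‖z - x‖.
  have step : ∀ m k : ℕ, (∀ z ∈ B, ‖iteratedFDeriv ℝ (m + 1) f z‖ ≤ K * ‖z - x‖ ^ k) →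
      ∀ z ∈ B, ‖iteratedFDeriv ℝ m f z - iteratedFDeriv ℝ m f x‖ ≤ K * ‖z - x‖ ^ (k + 1) := by
    intro m k hm z hz
    have hseg : segment ℝ x z ⊆ B := hB.segment_subset hx hz
    have := (convex_segment x z).norm_image_sub_le_of_norm_fderiv_le (𝕜 := ℝ)
      (f := iteratedFDeriv ℝ m f) (C := K * ‖z - x‖ ^ k) (x := x) (y := z)
      (fun w hw => hd m w (hseg hw)) (fun w hw => ?_)
      (left_mem_segment ℝ x z) (right_mem_segment ℝ x z)
    · rwa [mul_assoc, ← pow_succ] at this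
    · rw [norm_fderiv_iteratedFDeriv]
      refine (hm w (hseg hw)).trans ?_
      have : ‖w - x‖ ≤ ‖z - x‖ := by
        obtain ⟨t, ht, rfl⟩ := (segment_eq_image' ℝ x z) ▸ hw
        simp only [add_sub_cancel_left, norm_smul, Real.norm_eq_abs, abs_of_nonneg ht.1]
        exact mul_le_of_le_one_left (norm_nonneg _) ht.2
      gcongr
  -- Descent from order N + 1 to order 1; at each order the value at x vanishes. Order 0 is
  -- excluded, since f x need not vanish.
  have main : ∀ k m : ℕ, m + k = N + 1 → 1 ≤ m →
      ∀ z ∈ B, ‖iteratedFDeriv ℝ m f z‖ ≤ K * ‖z - x‖ ^ k := by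
    intro k
    induction k with
    | zero =>
      rintro m rfl _ z hz
      simpa using hK z hz
    | succ k ih =>
      intro m hm h1m z hz
      have h1 := step m k (ih (m + 1) (by omega) (by omega)) z hz
      rwa [h0 m h1m (by omega), sub_zero] at h1
  have h1 := step 0 N (main N (0 + 1) (by omega) (by omega)) y hy
  calc ‖f y - f x‖ = ‖(iteratedFDeriv ℝ 0 f y - iteratedFDeriv ℝ 0 f x) ![]‖ := by simp
    _ ≤ ‖iteratedFDeriv ℝ 0 f y - iteratedFDeriv ℝ 0 f x‖ := by
      simpa using ContinuousMultilinearMap.le_opNorm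
        (iteratedFDeriv ℝ 0 f y - iteratedFDeriv ℝ 0 f x) ![]
    _ ≤ _ := h1

/-- The image of a set is null if it is so locally. -/
theorem volume_image_null_of_locally {E : Type*} [TopologicalSpace E] [SecondCountableTopology E]
    {f : E → ℝ} {s : Set E} (h : ∀ x ∈ s, ∃ V ∈ 𝓝 x, volume (f '' (s ∩ V)) = 0) :
    volume (f '' s) = 0 := by
  have := measure_null_of_locally_null (μ := OuterMeasure.comap f volume.toOuterMeasure) s ?_
  · simpa using this
  · intro x hx
    obtain ⟨V, hV, h0⟩ := h x hx
    exact ⟨s ∩ V, inter_mem self_mem_nhdsWithin (mem_nhdsWithin_of_mem_nhds hV), by simpa using h0⟩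

/-- The image of the set of points at which the derivatives of order `1, …, N` of an analytic
function vanish is null if `N` is at least the dimension. -/
theorem volume_image_flat_eq_zero {E : Type*} [NormedAddCommGroup E] [NormedSpace ℝ E]
    [FiniteDimensional ℝ E] {f : E → ℝ} {s : Set E} {N : ℕ} (hN : Module.finrank ℝ E ≤ N)
    (hf : ∀ x ∈ s, ContDiffAt ℝ ω f x)
    (h0 : ∀ x ∈ s, ∀ j, 1 ≤ j → j ≤ N → iteratedFDeriv ℝ j f x = 0) :
    volume (f '' s) = 0 := by
  have : SecondCountableTopology E := secondCountable_of_proper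
  refine volume_image_null_of_locally fun x hx => ?_
  have hc : ContinuousAt (iteratedFDeriv ℝ (N + 1) f) x :=
    ((hf x hx).iteratedFDeriv_right (m := ω) (i := N + 1) (by simp)).continuousAt
  obtain ⟨K, hK⟩ : ∃ K : ℝ≥0, ∀ᶠ y in 𝓝 x, ‖iteratedFDeriv ℝ (N + 1) f y‖ ≤ K := by
    refine ⟨⟨‖iteratedFDeriv ℝ (N + 1) f x‖ + 1, by positivity⟩, ?_⟩
    exact (hc.norm.eventually_lt_const (lt_add_one _)).mono fun y hy => hy.le
  obtain ⟨r, hr, hB⟩ := Metric.eventually_nhds_iff_ball.1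
    (((hf x hx).eventually (by simp)).and hK)
  refine ⟨Metric.ball x r, Metric.ball_mem_nhds x hr, ?_⟩
  -- A Hölder exponent above 1 is possible because both points are taken in s, where the derivatives
  -- vanish. The image then has dimension at most N / (N + 1) < 1.
  have hol : HolderOnWith K (N + 1 : ℕ) f (s ∩ Metric.ball x r) := by
    intro y hy z hz
    have := norm_sub_le_of_iteratedFDeriv_eq_zero (convex_ball x r) (fun w hw => (hB w hw).1)
      (fun w hw => (hB w hw).2) hz.2 hy.2 (h0 z hz.1)
    rw [edist_dist, edist_dist, dist_eq_norm, dist_eq_norm]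
    rw [show ((K : ℝ≥0∞)) = ENNReal.ofReal K by simp, NNReal.coe_natCast, ENNReal.rpow_natCast,
      ← ENNReal.ofReal_pow (norm_nonneg _), ← ENNReal.ofReal_mul (by positivity)]
    exact ENNReal.ofReal_le_ofReal this
  have h1 := hol.dimH_image_le (by positivity)
  have h2 : dimH (s ∩ Metric.ball x r) ≤ N :=
    (dimH_mono (subset_univ _)).trans (by rw [Real.dimH_univ_eq_finrank]; exact_mod_cast hN)
  have h3 : dimH (f '' (s ∩ Metric.ball x r)) < (1 : ℝ≥0) := by
    refine h1.trans_lt ?_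
    refine ENNReal.div_lt_of_lt_mul ?_
    refine h2.trans_lt ?_
    simp only [ENNReal.coe_one, one_mul, ENNReal.coe_natCast]
    exact_mod_cast Nat.lt_succ_self N
  have h4 := hausdorffMeasure_of_dimH_lt h3
  rwa [NNReal.coe_one, hausdorffMeasure_real] at h4

/-- The zero set of an analytic function with nonzero derivative at `a` is locally parametrised by
a hyperplane. -/
theorem exists_analytic_parametrization {E : Type*} [NormedAddCommGroup E] [NormedSpace ℝ E]
    [FiniteDimensional ℝ E] {h : E → ℝ} {a : E} (hh : ContDiffAt ℝ ω h a) (ha : h a = 0)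
    (hd : fderiv ℝ h a ≠ 0) :
    ∃ (ψ : (fderiv ℝ h a).ker → E) (p : E → (fderiv ℝ h a).ker), ContDiffAt ℝ ω ψ (p a) ∧
      ContinuousAt p a ∧ ∀ᶠ y in 𝓝 a, h y = 0 → ψ (p y) = y := by
  have : CompleteSpace E := FiniteDimensional.complete ℝ E
  have hs : HasStrictFDerivAt h (fderiv ℝ h a) a := hh.hasStrictFDerivAt (by simp)
  have hr : (fderiv ℝ h a).range = ⊤ := by
    refine LinearMap.range_eq_top.2 (LinearMap.surjective ?_)
    intro h0
    exact hd (ContinuousLinearMap.coe_injective h0)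
  have hk : (fderiv ℝ h a).ker.ClosedComplemented :=
    (fderiv ℝ h a).ker_closedComplemented_of_finiteDimensional_range
  let φ := HasStrictFDerivAt.implicitFunctionDataOfComplemented h (fderiv ℝ h a) hs hr hk
  have hright : ContDiff ℝ ω φ.rightFun := by
    change ContDiff ℝ ω fun x => Classical.choose hk (x - a)
    exact (ContinuousLinearMap.contDiff _).comp (contDiff_id.sub contDiff_const)
  have hleft : φ.leftFun = h := rfl
  refine ⟨φ.implicitFunction 0, φ.rightFun, ?_, hright.continuous.continuousAt, ?_⟩
  · have h1 := ImplicitFunctionData.contDiffAt_implicitFunction (φ := φ) hh hright.contDiffAt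
      (by simp)
    have h2 : φ.prodFun φ.pt = (0, φ.rightFun a) := by
      rw [ImplicitFunctionData.prodFun_apply, hleft]
      exact Prod.ext ha rfl
    rw [h2] at h1
    exact h1.comp (φ.rightFun a) (contDiffAt_const.prodMk contDiffAt_id)
  · filter_upwards [φ.implicitFunction_apply_image] with y hy h0
    rwa [hleft, h0] at hy

/-- **Sard's theorem** for real-valued analytic functions: the set of critical values is null. -/
theorem volume_image_critical_eq_zero {E : Type*} [NormedAddCommGroup E] [NormedSpace ℝ E]
    [FiniteDimensional ℝ E] {f : E → ℝ} {s : Set E} (hf : ∀ x ∈ s, ContDiffAt ℝ ω f x)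
    (hd : ∀ x ∈ s, fderiv ℝ f x = 0) : volume (f '' s) = 0 := by
  obtain ⟨n, hn⟩ : ∃ n, Module.finrank ℝ E = n := ⟨_, rfl⟩
  induction n generalizing E with
  | zero =>
    have : Subsingleton E := Module.finrank_zero_iff.1 hn
    exact (Set.subsingleton_of_subsingleton.image f).measure_zero _
  | succ n ih =>
    have : SecondCountableTopology E := secondCountable_of_proper
    -- Stratification by order of flatness. The strata below order n + 1 lie locally in
    -- hypersurfaces and fall to the induction on the dimension; the rest is flat enough for the
    -- Hölder bound.
    let C : ℕ → Set E := fun k => {x ∈ s | ∀ j, 1 ≤ j → j ≤ k → iteratedFDeriv ℝ j f x = 0}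
    have hC1 : s ⊆ C 1 := by
      intro x hx
      refine ⟨hx, fun j h1 h2 => ?_⟩
      obtain rfl : j = 1 := le_antisymm h2 h1
      rw [← norm_eq_zero, norm_iteratedFDeriv_one, hd x hx, norm_zero]
    have hstep : ∀ k, 1 ≤ k → volume (f '' (C k \ C (k + 1))) = 0 := by
      intro k hk
      refine volume_image_null_of_locally fun a ha => ?_
      have hne : iteratedFDeriv ℝ (k + 1) f a ≠ 0 := by
        intro h0
        refine ha.2 ⟨ha.1.1, fun j h1 h2 => ?_⟩
        rcases Nat.lt_or_ge j (k + 1) with h | h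
        · exact ha.1.2 j h1 (by omega)
        · obtain rfl : j = k + 1 := le_antisymm h2 h
          exact h0
      obtain ⟨v, hv⟩ : ∃ v, iteratedFDeriv ℝ (k + 1) f a v ≠ 0 := by
        by_contra! hcon
        exact hne (ContinuousMultilinearMap.ext hcon)
      rw [iteratedFDeriv_succ_apply_left] at hv
      -- A component of the k-th derivative: it vanishes on C k, while its derivative at a in the
      -- direction v 0 does not. So C k lies near a in a smooth hypersurface.
      let h : E → ℝ := fun y => iteratedFDeriv ℝ k f y (Fin.tail v)
      have hfk : ContDiffAt ℝ ω (iteratedFDeriv ℝ k f) a :=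
        (hf a ha.1.1).iteratedFDeriv_right (m := ω) (i := k) (by simp)
      let ev := ContinuousMultilinearMap.apply ℝ (fun _ : Fin k => E) ℝ (Fin.tail v)
      have hh : ContDiffAt ℝ ω h a := ev.contDiff.contDiffAt.comp a hfk
      have hfd : fderiv ℝ h a = ev.comp (fderiv ℝ (iteratedFDeriv ℝ k f) a) :=
        (ev.hasFDerivAt.comp a (hfk.differentiableAt (by simp)).hasFDerivAt).fderiv
      have hh' : fderiv ℝ h a ≠ 0 := by
        intro h0
        apply hv
        have := DFunLike.congr_fun (hfd.symm.trans h0) (v 0)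
        simpa [ev] using this
      have hz : ∀ y ∈ C k, h y = 0 := fun y hy => by simp [h, hy.2 k hk le_rfl]
      obtain ⟨ψ, p, hψ, hp, hloc⟩ := exists_analytic_parametrization hh (hz a ha.1) hh'
      let s' : Set (fderiv ℝ h a).ker := {w | ψ w ∈ s ∧ ContDiffAt ℝ ω ψ w}
      have hrank : Module.finrank ℝ (fderiv ℝ h a).ker = n := by
        have h1 := (fderiv ℝ h a : E →ₗ[ℝ] ℝ).finrank_range_add_finrank_ker
        have h2 : (fderiv ℝ h a : E →ₗ[ℝ] ℝ).range = ⊤ := by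
          refine LinearMap.range_eq_top.2 (LinearMap.surjective fun h0 => hh' ?_)
          exact ContinuousLinearMap.coe_injective h0
        rw [h2, finrank_top, Module.finrank_self, hn] at h1
        have h3 : Module.finrank ℝ (fderiv ℝ h a).ker
          = Module.finrank ℝ (fderiv ℝ h a : E →ₗ[ℝ] ℝ).ker := rfl
        omega
      have h0 := ih (f := f ∘ ψ) (s := s') (fun w hw => (hf _ hw.1).comp w hw.2) (fun w hw => by
        rw [fderiv_comp w ((hf _ hw.1).differentiableAt (by simp))
          (hw.2.differentiableAt (by simp)), hd _ hw.1, ContinuousLinearMap.zero_comp]) hrank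
      have hev : ∀ᶠ y in 𝓝 a, (h y = 0 → ψ (p y) = y) ∧ ContDiffAt ℝ ω ψ (p y) :=
        hloc.and (hp.eventually (hψ.eventually (by simp)))
      refine ⟨_, hev, measure_mono_null ?_ h0⟩
      rintro _ ⟨y, ⟨hy, hy1, hy2⟩, rfl⟩
      have hy3 := hy1 (hz y hy.1)
      exact ⟨p y, ⟨by rw [hy3]; exact hy.1.1, hy2⟩, by simp [hy3]⟩
    have hcover : ∀ k, volume (f '' (s \ C (k + 1))) = 0 := by
      intro k
      induction k with
      | zero => rw [zero_add, Set.sdiff_eq_empty.2 hC1]; simp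
      | succ k ihk =>
        refine measure_mono_null ?_ (measure_union_null ihk (hstep (k + 1) (by omega)))
        rw [← Set.image_union]
        refine Set.image_mono fun x hx => ?_
        by_cases hxk : x ∈ C (k + 1)
        · exact Or.inr ⟨hxk, hx.2⟩
        · exact Or.inl ⟨hx.1, hxk⟩
    have hflat : volume (f '' C (n + 1)) = 0 :=
      volume_image_flat_eq_zero (N := n + 1) hn.le (fun x hx => hf x hx.1) fun x hx => hx.2
    refine measure_mono_null ?_ (measure_union_null (hcover n) hflat)
    rw [← Set.image_union]
    refine Set.image_mono fun x hx => ?_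
    by_cases hxk : x ∈ C (n + 1)
    · exact Or.inr hxk
    · exact Or.inl ⟨hx, hxk⟩

end Sard

/-! ### Separation theorems, multipliers and subgradients. -/

section Convex

open Set

/-- Fritz John's theorem for convex functions: if there is no point of `𝒳` at which all `h k` are
negative, then a nontrivial nonnegative combination of them is nonnegative on `𝒳`. -/
theorem exists_fritzJohn_multipliers {E K : Type*} [AddCommGroup E] [Module ℝ E] [Fintype K]
    {𝒳 : Set E} (hne : 𝒳.Nonempty) {h : K → E → ℝ} (hc : ∀ k, ConvexOn ℝ 𝒳 (h k))
    (h𝒳 : Convex ℝ 𝒳) (hno : ∀ z ∈ 𝒳, ∃ k, 0 ≤ h k z) :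
    ∃ lam : K → ℝ, (∀ k, 0 ≤ lam k) ∧ (∃ k, 0 < lam k) ∧ ∀ z ∈ 𝒳, 0 ≤ ∑ k, lam k * h k z := by
  classical
  -- An open convex set that misses 0; the multipliers are the coefficients of a functional
  -- separating it from 0.
  let A : Set (K → ℝ) := {r | ∃ z ∈ 𝒳, ∀ k, h k z < r k}
  have hA : Convex ℝ A := by
    rintro r ⟨z, hz, hr⟩ r' ⟨z', hz', hr'⟩ a b ha hb hab
    refine ⟨a • z + b • z', h𝒳 hz hz' ha hb hab, fun k => ?_⟩
    refine ((hc k).2 hz hz' ha hb hab).trans_lt ?_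
    simp only [smul_eq_mul, Pi.add_apply, Pi.smul_apply]
    rcases ha.eq_or_lt with rfl | ha
    · have : b = 1 := by linarith
      subst this
      simpa using hr' k
    · have h1 := mul_lt_mul_of_pos_left (hr k) ha
      have h2 := mul_le_mul_of_nonneg_left (hr' k).le hb
      linarith
  have hAo : IsOpen A := by
    have : A = ⋃ z ∈ 𝒳, ⋂ k, {r : K → ℝ | h k z < r k} := by ext; simp [A]
    rw [this]
    exact isOpen_biUnion fun z _ => isOpen_iInter_of_finite fun k =>
      isOpen_lt continuous_const (continuous_apply k)
  have h0 : (0 : K → ℝ) ∉ A := by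
    rintro ⟨z, hz, hr⟩
    obtain ⟨k, hk⟩ := hno z hz
    exact absurd (hr k) (not_lt.2 hk)
  obtain ⟨f, hf⟩ := geometric_hahn_banach_point_open hA hAo h0
  rw [map_zero] at hf
  have hfs : ∀ r : K → ℝ, f r = ∑ k, f (Pi.single k 1) * r k := by
    intro r
    conv_lhs => rw [← Finset.univ_sum_single r]
    rw [map_sum]
    refine Finset.sum_congr rfl fun k _ => ?_
    rw [show (Pi.single k (r k) : K → ℝ) = r k • Pi.single k 1 by
      rw [← Pi.single_smul, smul_eq_mul, mul_one], map_smul, smul_eq_mul, mul_comm]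
  have hnn : ∀ k, 0 ≤ f (Pi.single k 1) := by
    intro k
    obtain ⟨z, hz⟩ := hne
    -- A is stable under increasing a coordinate, so a negative coefficient would drive the
    -- functional below 0.
    by_contra! hk
    set c := f (fun j => h j z + 1)
    have h1 : ∀ t : ℝ, 0 ≤ t → 0 < c + t * f (Pi.single k 1) := by
      intro t ht
      have := hf ((fun j => h j z + 1) + t • Pi.single k 1) ⟨z, hz, fun j => by
        have h1 : 0 ≤ t * (Pi.single k 1 : K → ℝ) j :=
          mul_nonneg ht (by by_cases hj : j = k <;> simp [hj])
        simp only [Pi.add_apply, Pi.smul_apply, smul_eq_mul]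
        linarith⟩
      rwa [map_add, map_smul, smul_eq_mul] at this
    have hc0 : 0 < c := by simpa using h1 0 le_rfl
    have := h1 (c / -f (Pi.single k 1)) (div_nonneg hc0.le (by linarith))
    rw [div_mul_eq_mul_div, div_neg, mul_div_cancel_right₀ _ hk.ne] at this
    linarith
  refine ⟨fun k => f (Pi.single k 1), hnn, ?_, fun z hz => ?_⟩
  · by_contra! hcon
    obtain ⟨z, hz⟩ := hne
    have := hf (fun j => h j z + 1) ⟨z, hz, fun j => by linarith⟩
    rw [hfs, Finset.sum_eq_zero fun k _ => by rw [le_antisymm (hcon k) (hnn k), zero_mul]] at this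
    exact lt_irrefl _ this
  · refine le_of_forall_pos_lt_add fun ε hε => ?_
    set s := ∑ k, f (Pi.single k 1)
    have hs : 0 ≤ s := Finset.sum_nonneg fun k _ => hnn k
    have := hf (fun j => h j z + ε / (s + 1)) ⟨z, hz, fun j => by
      have : 0 < ε / (s + 1) := by positivity
      linarith⟩
    rw [hfs] at this
    simp only [mul_add, Finset.sum_add_distrib, ← Finset.sum_mul] at this
    refine this.trans_le ?_
    gcongr
    rw [mul_div_assoc', div_le_iff₀ (by positivity)]
    change s * ε ≤ ε * (s + 1)
    nlinarith

variable {E : Type*} [NormedAddCommGroup E] [InnerProductSpace ℝ E]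

/-- Sum rule for subgradients: if `x` minimises the sum of a continuous convex function `h` and
of a linear function over a convex set, then some subgradient of `h` certifies it. -/
theorem exists_subgradient_of_minimizer [CompleteSpace E] {h : E → ℝ} (hh : ConvexOn ℝ univ h)
    (hcont : Continuous h) {𝒳 : Set E} (h𝒳 : Convex ℝ 𝒳) {x : E} (hx : x ∈ 𝒳) (l : E)
    (hmin : ∀ z ∈ 𝒳, h x ≤ h z + ⟪l, z - x⟫_ℝ) :
    ∃ ξ : E, (∀ z, h x + ⟪ξ, z - x⟫_ℝ ≤ h z) ∧ ∀ z ∈ 𝒳, 0 ≤ ⟪ξ + l, z - x⟫_ℝ := by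
  -- The strict epigraph of h is separated from the part over 𝒳 of the hypograph of an affine
  -- function; minimality makes them disjoint.
  let A : Set (E × ℝ) := {p | h p.1 < p.2}
  let B : Set (E × ℝ) := {p | p.1 ∈ 𝒳 ∧ p.2 ≤ h x - ⟪l, p.1 - x⟫_ℝ}
  have hA : Convex ℝ A := by simpa [A] using hh.convex_strict_epigraph
  have hAo : IsOpen A := isOpen_lt (hcont.comp continuous_fst) continuous_snd
  have hB : Convex ℝ B := by
    rintro ⟨z, r⟩ ⟨hz, hr⟩ ⟨z', r'⟩ ⟨hz', hr'⟩ a b ha hb hab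
    refine ⟨h𝒳 hz hz' ha hb hab, ?_⟩
    have e : a • z + b • z' - x = a • (z - x) + b • (z' - x) := by
      have : x = (a + b) • x := by rw [hab, one_smul]
      conv_lhs => rw [this]
      module
    simp only [Prod.smul_mk, Prod.mk_add_mk, smul_eq_mul] at hr hr' ⊢
    rw [e, inner_add_right, inner_smul_right, inner_smul_right]
    have h1 := mul_le_mul_of_nonneg_left hr ha
    have h2 := mul_le_mul_of_nonneg_left hr' hb
    have h3 : h x = a * h x + b * h x := by rw [← add_mul, hab, one_mul]
    linarith
  have hdisj : Disjoint A B := by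
    rw [Set.disjoint_left]
    rintro ⟨z, r⟩ h1 ⟨h2, h3⟩
    have h4 : h z < r := h1
    have := hmin z h2
    simp only at h3
    linarith
  obtain ⟨f, u, hfA, hfB⟩ := geometric_hahn_banach_open hA hAo hB hdisj
  set g : StrongDual ℝ E := f.comp (ContinuousLinearMap.inl ℝ E ℝ) with hg
  set s : ℝ := f (0, 1) with hs
  have hf : ∀ z r, f (z, r) = g z + r * s := by
    intro z r
    have : ((z, r) : E × ℝ) = (z, 0) + r • (0, 1) := by simp
    rw [this, map_add, map_smul, smul_eq_mul]
    rfl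
  have hxB : u ≤ g x + h x * s := by
    rw [← hf]
    exact hfB _ ⟨hx, by simp⟩
  -- The hyperplane is not vertical, because h is finite on the whole space and (x, h x + 1) lies
  -- above the contact point. Hence no constraint qualification is needed.
  have hs0 : s < 0 := by
    have := hfA (x, h x + 1) (by simp [A])
    rw [hf] at this
    linarith
  have hle : ∀ z, g z + h z * s ≤ u := by
    intro z
    refine le_of_forall_pos_lt_add fun ε hε => ?_
    have := hfA (z, h z + ε / -s) (lt_add_of_pos_right _ (div_pos hε (by linarith)))
    rw [hf, add_mul, div_neg, neg_mul, div_mul_cancel₀ _ hs0.ne] at this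
    linarith
  set ξ := (InnerProductSpace.toDual ℝ E).symm ((-s)⁻¹ • g) with hξ
  have hin : ∀ w, ⟪ξ, w⟫_ℝ = (-s)⁻¹ * g w := by
    intro w
    rw [hξ, InnerProductSpace.toDual_symm_apply]
    rfl
  refine ⟨ξ, fun z => ?_, fun z hz => ?_⟩
  · rw [hin, map_sub]
    have := (hle z).trans hxB
    have h1 : (-s)⁻¹ * (g z - g x) ≤ h z - h x := by
      rw [inv_mul_le_iff₀ (by linarith)]
      linarith
    linarith
  · rw [inner_add_left, hin, map_sub]
    have h1 := (hle x).trans (hfB (z, h x - ⟪l, z - x⟫_ℝ) ⟨hz, le_rfl⟩)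
    rw [hf] at h1
    have h2 : -⟪l, z - x⟫_ℝ ≤ (-s)⁻¹ * (g z - g x) := by
      rw [le_inv_mul_iff₀ (by linarith)]
      linarith
    linarith

/-- The gradient is a Fréchet subgradient. -/
theorem mem_subdiff_of_hasFDerivAt {f : E → ℝ} {ξ x : E}
    (hf : HasFDerivAt f (innerSL ℝ ξ) x) : ξ ∈ subdiff f x := by
  intro ε hε
  filter_upwards [hf.isLittleO.def hε] with z hz
  rw [Real.norm_eq_abs, abs_le] at hz
  have := hz.1
  simp only [innerSL_apply_apply] at this
  linarith

/-- A subgradient of a convex minorant up to second order is a Fréchet subgradient. -/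
theorem mem_subdiff_of_sq_minorant {f h : E → ℝ} {ξ x : E} {C : ℝ} (hx : f x = h x)
    (hfh : ∀ z, h z - C * ‖z - x‖ ^ 2 ≤ f z) (hξ : ∀ z, h x + ⟪ξ, z - x⟫_ℝ ≤ h z) :
    ξ ∈ subdiff f x := by
  intro ε hε
  have hlim : Tendsto (fun z => C * ‖z - x‖) (𝓝 x) (𝓝 0) := by
    have : Continuous fun z => C * ‖z - x‖ := by fun_prop
    simpa using this.tendsto x
  filter_upwards [hlim.eventually_lt_const hε] with z hz
  have h1 := hfh z
  have h2 := hξ z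
  have h3 := mul_le_mul_of_nonneg_right hz.le (norm_nonneg (z - x))
  rw [hx]
  nlinarith

end Convex

/-! ### The smallest eigenvalue: continuity, concavity, positivity. -/

section MinEig

variable {n : Type*} [Fintype n]

theorem abs_dotProduct_mulVec_le (A : Matrix n n ℝ) (v : n → ℝ) :
    |v ⬝ᵥ (A *ᵥ v)| ≤ (∑ i, ∑ j, |A i j|) * (v ⬝ᵥ v) := by
  have hsq : ∀ i, v i ^ 2 ≤ v ⬝ᵥ v := fun i => by
    simp only [dotProduct, ← pow_two]
    exact Finset.single_le_sum (f := fun i => v i ^ 2) (fun i _ => sq_nonneg _) (Finset.mem_univ i)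
  have he : v ⬝ᵥ (A *ᵥ v) = ∑ i, ∑ j, A i j * (v i * v j) := by
    simp only [dotProduct, Matrix.mulVec, Finset.mul_sum]
    exact Finset.sum_congr rfl fun i _ => Finset.sum_congr rfl fun j _ => by ring
  rw [he, Finset.sum_mul]
  refine (Finset.abs_sum_le_sum_abs _ _).trans (Finset.sum_le_sum fun i _ => ?_)
  rw [Finset.sum_mul]
  refine (Finset.abs_sum_le_sum_abs _ _).trans (Finset.sum_le_sum fun j _ => ?_)
  rw [abs_mul]
  refine mul_le_mul_of_nonneg_left ?_ (abs_nonneg _)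
  rw [abs_le]
  constructor <;> nlinarith [hsq i, hsq j, sq_nonneg (v i + v j), sq_nonneg (v i - v j)]

theorem dotProduct_self_pos {v : n → ℝ} (hv : v ≠ 0) : 0 < v ⬝ᵥ v :=
  lt_of_le_of_ne (Finset.sum_nonneg fun _ _ => mul_self_nonneg _)
    fun h => hv (dotProduct_self_eq_zero.1 h.symm)

/-- Clears the denominator of the Rayleigh quotient, after which v = 0 is harmless. Symmetry plays
no role; the crude entrywise bound supplies the boundedness below. -/
theorem le_minEig_iff [Nonempty n] {A : Matrix n n ℝ} {c : ℝ} :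
    c ≤ minEig A ↔ ∀ v : n → ℝ, c * (v ⬝ᵥ v) ≤ v ⬝ᵥ (A *ᵥ v) := by
  have hbdd : BddBelow (Set.range fun v : {v : n → ℝ // v ≠ 0} =>
      (v.1 ⬝ᵥ (A *ᵥ v.1)) / (v.1 ⬝ᵥ v.1)) := by
    refine ⟨-∑ i, ∑ j, |A i j|, ?_⟩
    rintro _ ⟨⟨v, hv⟩, rfl⟩
    simp only
    rw [le_div_iff₀ (dotProduct_self_pos hv), neg_mul]
    exact (abs_le.1 (abs_dotProduct_mulVec_le A v)).1
  have : Nonempty {v : n → ℝ // v ≠ 0} := ⟨⟨fun _ => 1, fun h => by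
    simpa using congrFun h (Classical.arbitrary n)⟩⟩
  rw [minEig, le_ciInf_iff hbdd]
  constructor
  · intro h v
    by_cases hv : v = 0
    · simp [hv]
    · exact (le_div_iff₀ (dotProduct_self_pos hv)).1 (h ⟨v, hv⟩)
  · rintro h ⟨v, hv⟩
    exact (le_div_iff₀ (dotProduct_self_pos hv)).2 (h v)

theorem minEig_mul_le [Nonempty n] (A : Matrix n n ℝ) (v : n → ℝ) :
    minEig A * (v ⬝ᵥ v) ≤ v ⬝ᵥ (A *ᵥ v) :=
  le_minEig_iff.1 le_rfl v

theorem minEig_le_add [Nonempty n] (A B : Matrix n n ℝ) :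
    minEig A ≤ minEig B + ∑ i, ∑ j, |A i j - B i j| := by
  rw [← sub_le_iff_le_add, le_minEig_iff]
  intro v
  have h1 := minEig_mul_le A v
  have h2 := (abs_le.1 (abs_dotProduct_mulVec_le (A - B) v)).2
  rw [Matrix.sub_mulVec, dotProduct_sub] at h2
  simp only [Matrix.sub_apply] at h2
  linarith

theorem continuous_minEig [Nonempty n] : Continuous (minEig : Matrix n n ℝ → ℝ) := by
  rw [continuous_iff_continuousAt]
  intro A
  have h : Tendsto (fun B : Matrix n n ℝ => ∑ i, ∑ j, |B i j - A i j|) (𝓝 A) (𝓝 0) := by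
    have : Continuous fun B : Matrix n n ℝ => ∑ i, ∑ j, |B i j - A i j| := by fun_prop
    simpa using this.tendsto A
  refine tendsto_of_tendsto_of_tendsto_of_le_of_le
    (g := fun B => minEig A - ∑ i, ∑ j, |B i j - A i j|)
    (h := fun B => minEig A + ∑ i, ∑ j, |B i j - A i j|) ?_ ?_ (fun B => ?_) (fun B => ?_)
  · simpa using tendsto_const_nhds.sub h
  · simpa using tendsto_const_nhds.add h
  · have := minEig_le_add A B
    simp only [abs_sub_comm (A _ _)] at this
    simpa using this
  · exact minEig_le_add B A

/-- An infimum of linear functions of the matrix is superadditive and positively homogeneous, so the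
weights need not sum to 1. -/
theorem minEig_concave [Nonempty n] {A B : Matrix n n ℝ} {a b : ℝ} (ha : 0 ≤ a) (hb : 0 ≤ b) :
    a * minEig A + b * minEig B ≤ minEig (a • A + b • B) := by
  rw [le_minEig_iff]
  intro v
  rw [Matrix.add_mulVec, Matrix.smul_mulVec, Matrix.smul_mulVec, dotProduct_add, dotProduct_smul,
    dotProduct_smul, smul_eq_mul, smul_eq_mul]
  have h1 := mul_le_mul_of_nonneg_left (minEig_mul_le A v) ha
  have h2 := mul_le_mul_of_nonneg_left (minEig_mul_le B v) hb
  linarith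

/-- Strictness survives the infimum because a symmetric matrix attains it at an eigenvector. -/
theorem minEig_pos [DecidableEq n] [Nonempty n] {A : Matrix n n ℝ} (hA : A.IsSymm)
    (h : ∀ v : n → ℝ, v ≠ 0 → 0 < v ⬝ᵥ (A *ᵥ v)) : 0 < minEig A := by
  obtain ⟨v, hv⟩ := (isLeast_minEig A hA).1.exists_hasEigenvector
  have hAv : A *ᵥ v = minEig A • v := by simpa using hv.apply_eq_smul
  have h1 := h v hv.2
  rw [hAv, dotProduct_smul, smul_eq_mul] at h1
  exact pos_of_mul_pos_left h1 (dotProduct_self_pos hv.2).le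

end MinEig

/-! ### The analytic structure of the Fisher matrix, its surrogate and the linearised constraints.
-/

section Model

open scoped ContDiff

variable {ι : Type*} {D : Scenario ι}

/-! ### The functions `y` -/

/-- Not strict: the energy sum may vanish, and then the quotient is 0 by the convention for division
by zero. -/
theorem Scenario.crlbτ_nonneg (D : Scenario ι) (n : ι) : 0 ≤ D.crlbτ n := by
  have := D.E_pos
  have := D.σ2_pos n
  unfold Scenario.crlbτ
  positivity

theorem Scenario.crlbα_nonneg (D : Scenario ι) (n : ι) : 0 ≤ D.crlbα n := by
  have := D.E_pos
  have := D.σ2_pos n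
  unfold Scenario.crlbα
  positivity

theorem Scenario.posDef_Qr (D : Scenario ι) (n : ι) : (D.Qr n).PosDef := by
  have hE := D.E_pos
  have hσ := D.σ2_pos n
  have hτ := D.crlbτ_nonneg n
  have hα := D.crlbα_nonneg n
  have h : ∀ p : D.Idx n → ℝ, (Matrix.vecMulVec p p).PosSemidef := fun p => by
    simpa using Matrix.posSemidef_vecMulVec_self_star p
  unfold Scenario.Qr
  refine Matrix.PosDef.posSemidef_add (((h _).smul ?_).add ((h _).smul ?_) |>.add
    ((h _).smul ?_)) (Matrix.PosDef.one.smul ?_)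
  all_goals positivity

/-- The noise term σ²/2 · I makes the covariance positive definite, and conjugation by the
orthogonal factor preserves this. -/
theorem KLT.γ_pos (T : KLT D) (n : ι) (j : D.Idx n) : 0 < T.γ n j := by
  have hU := T.orthogonal n
  have hU' : star (T.U n) * T.U n = 1 := (Matrix.mem_orthogonalGroup_iff' _ _).1 hU
  have hunit : IsUnit (T.U n) := IsUnit.of_mul_eq_one_right _ hU'
  have h1 := (Matrix.IsUnit.posDef_star_left_conjugate_iff hunit).2 (D.posDef_Qr n)
  have h2 : star (T.U n) * D.Qr n * T.U n = Matrix.diagonal (T.γ n) := by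
    rw [T.decomp n, ← mul_assoc, ← mul_assoc, hU', one_mul, mul_assoc]
    have : (T.U n)ᵀ * T.U n = 1 := by simpa [Matrix.star_eq_conjTranspose] using hU'
    rw [this, mul_one]
  rw [h2, Matrix.posDef_diagonal_iff] at h1
  exact h1 j

/-- A rescaled logistic function: analyticity, a positive slope and a globally bounded second
derivative all follow from this form. -/
theorem yfun_eq_sigmoid (T : KLT D) (n : D.Ω) (j : D.Idx n) (X : ℝ) :
    yfun T n j X = 2 / D.σ2 n *
      Real.sigmoid (2 * Real.log 2 * X - Real.log (4 * T.γ n j / D.σ2 n)) := by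
  have hσ := D.σ2_pos n
  have hγ := T.γ_pos n j
  have h2 : (0 : ℝ) < 2 := two_pos
  have hu : (0 : ℝ) < 2 ^ (2 * X) := by positivity
  have e1 : (2 : ℝ) ^ (2 * X - 1) = 2 ^ (2 * X) / 2 := by rw [Real.rpow_sub h2, Real.rpow_one]
  have e2 : (2 : ℝ) ^ (2 * X - 2) = 2 ^ (2 * X) / 4 := by
    rw [Real.rpow_sub h2, Real.rpow_two]; norm_num
  have e3 : Real.exp (-(2 * Real.log 2 * X - Real.log (4 * T.γ n j / D.σ2 n)))
      = (4 * T.γ n j / D.σ2 n) / 2 ^ (2 * X) := by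
    rw [neg_sub, Real.exp_sub, Real.exp_log (by positivity), Real.rpow_def_of_pos h2]
    congr 2
    ring
  rw [yfun, Real.sigmoid_def, e1, e2, e3]
  field_simp
  ring

/-- The derivative of `y_n`. -/
noncomputable def ySlope (T : KLT D) (n : D.Ω) (j : D.Idx n) (X : ℝ) : ℝ :=
  let p := Real.sigmoid (2 * Real.log 2 * X - Real.log (4 * T.γ n j / D.σ2 n))
  2 / D.σ2 n * (2 * Real.log 2) * (p * (1 - p))

theorem hasDerivAt_sigmoid_affine (b c X : ℝ) :
    HasDerivAt (fun X => Real.sigmoid (b * X - c))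
      (b * (Real.sigmoid (b * X - c) * (1 - Real.sigmoid (b * X - c)))) X := by
  have h : HasDerivAt (fun X : ℝ => b * X - c) b X := by
    simpa using ((hasDerivAt_id X).const_mul b).sub_const c
  have := (Real.hasDerivAt_sigmoid (b * X - c)).comp X h
  rw [mul_comm] at this
  exact this

theorem hasDerivAt_yfun (T : KLT D) (n : D.Ω) (j : D.Idx n) (X : ℝ) :
    HasDerivAt (yfun T n j) (ySlope T n j X) X := by
  rw [funext (yfun_eq_sigmoid T n j)]
  refine ((hasDerivAt_sigmoid_affine _ _ X).const_mul _).congr_deriv ?_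
  simp only [ySlope]
  ring

theorem deriv_yfun (T : KLT D) (n : D.Ω) (j : D.Idx n) (X : ℝ) :
    deriv (yfun T n j) X = ySlope T n j X :=
  (hasDerivAt_yfun T n j X).deriv

theorem ySlope_pos (T : KLT D) (n : D.Ω) (j : D.Idx n) (X : ℝ) : 0 < ySlope T n j X := by
  have hσ := D.σ2_pos n
  have hl := Real.log_pos one_lt_two
  have h1 := Real.sigmoid_pos (2 * Real.log 2 * X - Real.log (4 * T.γ n j / D.σ2 n))
  have h2 := sub_pos.2
    (Real.sigmoid_lt_one (2 * Real.log 2 * X - Real.log (4 * T.γ n j / D.σ2 n)))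
  simp only [ySlope]
  positivity

theorem contDiff_yfun (T : KLT D) (n : D.Ω) (j : D.Idx n) : ContDiff ℝ ω (yfun T n j) := by
  rw [funext (yfun_eq_sigmoid T n j)]
  refine contDiff_const.mul (contDiff_sigmoid.comp ?_)
  fun_prop

theorem continuous_ySlope (T : KLT D) (n : D.Ω) (j : D.Idx n) : Continuous (ySlope T n j) := by
  have := differentiable_sigmoid.continuous
  unfold ySlope
  fun_prop

/-- The second derivative is a constant times p(1 - p)(1 - 2p) with p in (0, 1), so the Lipschitz
constant depends neither on X nor on γ. -/
theorem abs_ySlope_sub_le (T : KLT D) (n : D.Ω) (j : D.Idx n) (X X' : ℝ) :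
    |ySlope T n j X' - ySlope T n j X| ≤
      2 / D.σ2 n * (2 * Real.log 2) * (2 * Real.log 2) * |X' - X| := by
  have hσ := D.σ2_pos n
  have hl := Real.log_pos one_lt_two
  set b := 2 * Real.log 2 with hb
  set c := Real.log (4 * T.γ n j / D.σ2 n)
  have hd : ∀ Y ∈ (Set.univ : Set ℝ), HasDerivWithinAt (ySlope T n j)
      (2 / D.σ2 n * b * (b * (Real.sigmoid (b * Y - c) * (1 - Real.sigmoid (b * Y - c))) *
        (1 - 2 * Real.sigmoid (b * Y - c)))) Set.univ Y := by
    intro Y _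
    have h := hasDerivAt_sigmoid_affine b c Y
    refine (((h.mul (h.const_sub 1)).const_mul (2 / D.σ2 n * b)).congr_deriv ?_).hasDerivWithinAt
    ring
  have := convex_univ.norm_image_sub_le_of_norm_hasDerivWithin_le
    (C := 2 / D.σ2 n * b * b) hd (fun Y _ => ?_) (Set.mem_univ X) (Set.mem_univ X')
  · simpa only [Real.norm_eq_abs] using this
  · have h1 := Real.sigmoid_pos (b * Y - c)
    have h2 := Real.sigmoid_lt_one (b * Y - c)
    set p := Real.sigmoid (b * Y - c)
    have h3 : |p * (1 - p) * (1 - 2 * p)| ≤ 1 := by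
      rw [abs_mul]
      refine mul_le_one₀ ?_ (abs_nonneg _) ?_ <;> rw [abs_le] <;> constructor <;> nlinarith
    rw [show 2 / D.σ2 n * b * (b * (p * (1 - p)) * (1 - 2 * p))
      = 2 / D.σ2 n * b * b * (p * (1 - p) * (1 - 2 * p)) by ring, Real.norm_eq_abs, abs_mul,
      abs_of_nonneg (by positivity : 0 ≤ 2 / D.σ2 n * b * b)]
    exact mul_le_of_le_one_right (by positivity) h3

/-- The error of the tangent is quadratic. -/
theorem abs_yfun_sub_tangent_le (T : KLT D) (n : D.Ω) (j : D.Idx n) (Xt X : ℝ) :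
    |yfun T n j X - tangent T n j Xt X| ≤
      2 / D.σ2 n * (2 * Real.log 2) * (2 * Real.log 2) * |X - Xt| ^ 2 := by
  have hσ := D.σ2_pos n
  have hl := Real.log_pos one_lt_two
  set L := 2 / D.σ2 n * (2 * Real.log 2) * (2 * Real.log 2)
  have hL : 0 ≤ L := by positivity
  have h := (convex_uIcc Xt X).norm_image_sub_le_of_norm_hasDerivWithin_le
    (f := fun Y => yfun T n j Y - ySlope T n j Xt * Y)
    (f' := fun Y => ySlope T n j Y - ySlope T n j Xt) (C := L * |X - Xt|)
    (fun Y _ => ((hasDerivAt_yfun T n j Y).sub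
      (by simpa using (hasDerivAt_id Y).const_mul (ySlope T n j Xt))).hasDerivWithinAt)
    (fun Y hY => ?_) Set.left_mem_uIcc Set.right_mem_uIcc
  · rw [Real.norm_eq_abs, Real.norm_eq_abs, mul_assoc, ← pow_two] at h
    rw [tangent, deriv_yfun]
    convert h using 2
    ring
  · refine (abs_ySlope_sub_le T n j Xt Y).trans (mul_le_mul_of_nonneg_left ?_ hL)
    exact Set.abs_sub_left_of_mem_uIcc hY

/-! ### Linearity of the variables -/

theorem bits_add (x z : Var D) (n j) : bits (x + z) n j = bits x n j + bits z n j := rfl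
theorem bits_sub (x z : Var D) (n j) : bits (x - z) n j = bits x n j - bits z n j := rfl
theorem bits_smul (a : ℝ) (x : Var D) (n j) : bits (a • x) n j = a * bits x n j := rfl
theorem uses_add (x z : Var D) : uses (x + z) = uses x + uses z := rfl
theorem uses_sub (x z : Var D) : uses (x - z) = uses x - uses z := rfl
theorem uses_smul (a : ℝ) (x : Var D) : uses (a • x) = a * uses x := rfl
theorem aux_add (x z : Var D) : aux (x + z) = aux x + aux z := rfl
theorem aux_smul (a : ℝ) (x : Var D) : aux (a • x) = a • aux x := rfl

theorem continuous_bits (n : D.Ω) (j : D.Idx n) : Continuous fun x : Var D => bits x n j := by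
  unfold bits; fun_prop

theorem continuous_uses : Continuous (uses : Var D → ℝ) := by
  unfold uses; fun_prop

theorem continuous_aux : Continuous (aux : Var D → Matrix (Fin 2) (Fin 2) ℝ) := by
  refine continuous_matrix fun i k => ?_
  simp only [aux, Matrix.of_apply]
  fun_prop

theorem abs_bits_le (x : Var D) (n j) : |bits x n j| ≤ ‖x‖ :=
  PiLp.norm_apply_le x (Sum.inl ⟨n, j⟩)

theorem abs_uses_le (x : Var D) : |uses x| ≤ ‖x‖ :=
  PiLp.norm_apply_le x (Sum.inr (Sum.inl ()))

theorem convex_domain : Convex ℝ (domain D) := by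
  rintro x ⟨hx1, hx2, hx3⟩ z ⟨hz1, hz2, hz3⟩ a b ha hb hab
  refine ⟨fun n j => ?_, ?_, ?_⟩
  · rw [bits_add, bits_smul, bits_smul]
    exact add_nonneg (mul_nonneg ha (hx1 n j)) (mul_nonneg hb (hz1 n j))
  · rw [uses_add, uses_smul, uses_smul]
    rcases ha.eq_or_lt with rfl | ha
    · obtain rfl : b = 1 := by linarith
      simpa using hz2
    · nlinarith [mul_pos ha hx2, mul_nonneg hb hz2.le]
  · rw [aux_add, aux_smul, aux_smul, Matrix.IsSymm, Matrix.transpose_add, Matrix.transpose_smul,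
      Matrix.transpose_smul, hx3.eq, hz3.eq]

/-! ### The Fisher information matrix -/

/-- `∑ₙ (∂sₙ Uₙ) diag(y_n) (∂sₙ Uₙ)ᵀ`. -/
noncomputable def info (T : KLT D) (y : (n : D.Ω) → D.Idx n → ℝ) : Matrix (Fin 2) (Fin 2) ℝ :=
  ∑ n : D.Ω, (D.jac n * T.U n) * Matrix.diagonal (y n) * (D.jac n * T.U n)ᵀ

/-- The columns of `∂sₙ Uₙ`. -/
noncomputable def col (T : KLT D) (n : D.Ω) (j : D.Idx n) (k : Fin 2) : ℝ := (D.jac n * T.U n) k j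

theorem info_apply (T : KLT D) (y : (n : D.Ω) → D.Idx n → ℝ) (k l : Fin 2) :
    info T y k l = ∑ n, ∑ j, y n j * (col T n j k * col T n j l) := by
  rw [info, Matrix.sum_apply]
  refine Finset.sum_congr rfl fun n _ => ?_
  rw [Matrix.mul_apply]
  refine Finset.sum_congr rfl fun j _ => ?_
  rw [Matrix.mul_diagonal, Matrix.transpose_apply]
  simp only [col]
  ring

theorem info_isSymm (T : KLT D) (y : (n : D.Ω) → D.Idx n → ℝ) : (info T y).IsSymm := by
  ext k l
  rw [Matrix.transpose_apply, info_apply, info_apply]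
  simp only [mul_comm (col T _ _ k)]

theorem info_combination (T : KLT D) (y y' : (n : D.Ω) → D.Idx n → ℝ) (a b : ℝ) :
    info T (fun n j => a * y n j + b * y' n j) = a • info T y + b • info T y' := by
  ext k l
  simp only [info_apply, Matrix.add_apply, Matrix.smul_apply, smul_eq_mul, Finset.mul_sum,
    ← Finset.sum_add_distrib]
  refine Finset.sum_congr rfl fun n _ => Finset.sum_congr rfl fun j _ => ?_
  ring

/-- Noise and quantisation covariances are both diagonal in the basis U, so the inverse is taken
entrywise; `yfun` is the reciprocal of the diagonal entry. -/
theorem fisher_eq_info (T : KLT D) (x : Var D) :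
    fisher T x = info T fun n j => yfun T n j (bits x n j) := by
  unfold fisher info
  refine Finset.sum_congr rfl fun n _ => ?_
  have hσ := D.σ2_pos n
  have hU : T.U n * (T.U n)ᵀ = 1 := by
    simpa [Matrix.star_eq_conjTranspose] using
      (Matrix.mem_orthogonalGroup_iff _ _).1 (T.orthogonal n)
  have hU' : (T.U n)ᵀ * T.U n = 1 := by
    simpa [Matrix.star_eq_conjTranspose] using
      (Matrix.mem_orthogonalGroup_iff' _ _).1 (T.orthogonal n)
  have hinv : ((1 / 2 * D.σ2 n) • (1 : Matrix (D.Idx n) (D.Idx n) ℝ) + quantCov T x n)⁻¹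
      = T.U n * Matrix.diagonal (fun j => yfun T n j (bits x n j)) * (T.U n)ᵀ := by
    refine Matrix.inv_eq_right_inv ?_
    have h1 : (1 / 2 * D.σ2 n) • (1 : Matrix (D.Idx n) (D.Idx n) ℝ) + quantCov T x n
        = T.U n * Matrix.diagonal (fun j => 1 / 2 * D.σ2 n +
          T.γ n j / (2 : ℝ) ^ (2 * bits x n j - 1)) * (T.U n)ᵀ := by
      rw [quantCov, ← Matrix.diagonal_add, mul_add, add_mul, ← Matrix.smul_one_eq_diagonal,
        Matrix.mul_smul, Matrix.smul_mul, mul_one, hU]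
    rw [h1]
    have h2 : Matrix.diagonal (fun j => 1 / 2 * D.σ2 n +
          T.γ n j / (2 : ℝ) ^ (2 * bits x n j - 1)) *
        Matrix.diagonal (fun j => yfun T n j (bits x n j)) = 1 := by
      rw [Matrix.diagonal_mul_diagonal, ← Matrix.diagonal_one]
      congr 1
      ext j
      have hγ := T.γ_pos n j
      have hp : (0 : ℝ) < 2 ^ (2 * bits x n j - 1) := by positivity
      have e : (2 : ℝ) ^ (2 * bits x n j - 2) = 2 ^ (2 * bits x n j - 1) / 2 := by
        rw [show 2 * bits x n j - 2 = (2 * bits x n j - 1) - 1 by ring,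
          Real.rpow_sub two_pos (2 * bits x n j - 1), Real.rpow_one]
      rw [yfun, e]
      field_simp
      ring
    have hmul : ∀ A B : Matrix (D.Idx n) (D.Idx n) ℝ, T.U n * A * (T.U n)ᵀ * (T.U n * B * (T.U n)ᵀ)
        = T.U n * (A * ((T.U n)ᵀ * T.U n) * B) * (T.U n)ᵀ := fun A B => by
      simp only [Matrix.mul_assoc]
    rw [hmul, hU', mul_one, h2, mul_one, hU]
  rw [hinv, Matrix.transpose_mul]
  simp only [Matrix.mul_assoc]

theorem fisherSurr_eq_info (T : KLT D) (x z : Var D) :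
    fisherSurr T x z = info T fun n j => tangent T n j (bits x n j) (bits z n j) := rfl

theorem fisherSurr_self (T : KLT D) (x : Var D) : fisherSurr T x x = fisher T x := by
  rw [fisher_eq_info, fisherSurr_eq_info]
  simp [tangent]

theorem fisherSurr_combination (T : KLT D) (x z w : Var D) {a b : ℝ} (hab : a + b = 1) :
    fisherSurr T x (a • z + b • w) = a • fisherSurr T x z + b • fisherSurr T x w := by
  simp only [fisherSurr_eq_info, ← info_combination, bits_add, bits_smul, tangent]
  congr 1
  ext n j
  linear_combination (bits x n j * deriv (yfun T n j) (bits x n j)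
    - yfun T n j (bits x n j)) * hab

theorem continuous_fisherSurr (T : KLT D) :
    Continuous fun p : Var D × Var D => fisherSurr T p.1 p.2 := by
  refine continuous_matrix fun k l => ?_
  simp only [fisherSurr_eq_info, info_apply, tangent, deriv_yfun]
  refine continuous_finsetSum _ fun n _ => continuous_finsetSum _ fun j _ => ?_
  have h1 := (continuous_bits n j).comp (continuous_fst (X := Var D) (Y := Var D))
  have h2 := (continuous_bits n j).comp (continuous_snd (X := Var D) (Y := Var D))
  have h3 := (continuous_ySlope T n j).comp h1
  have h4 := (contDiff_yfun T n j).continuous.comp h1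
  exact (((h2.sub h1).mul h3).add h4).mul continuous_const

/-- The error of the surrogate of the matrix constraint is quadratic. -/
theorem exists_abs_minEig_sub_le (T : KLT D) : ∃ C : ℝ, 0 ≤ C ∧ ∀ x z : Var D,
    |minEig (blockMat (aux z) (fisher T z)) - minEig (blockMat (aux z) (fisherSurr T x z))|
      ≤ C * ‖z - x‖ ^ 2 := by
  have hl := Real.log_pos one_lt_two
  let L : D.Ω → ℝ := fun n => 2 / D.σ2 n * (2 * Real.log 2) * (2 * Real.log 2)
  have hL : ∀ n, 0 ≤ L n := fun n => by
    have := D.σ2_pos n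
    positivity
  let c : Fin 2 → Fin 2 → ℝ := fun k l => ∑ n, ∑ j, L n * |col T n j k * col T n j l|
  have hc : ∀ k l, 0 ≤ c k l := fun k l => Finset.sum_nonneg fun n _ => Finset.sum_nonneg
    fun j _ => mul_nonneg (hL n) (abs_nonneg _)
  refine ⟨∑ k, ∑ l, c k l, Finset.sum_nonneg fun k _ => Finset.sum_nonneg fun l _ => hc k l,
    fun x z => ?_⟩
  have hentry : ∀ k l, |fisher T z k l - fisherSurr T x z k l| ≤ c k l * ‖z - x‖ ^ 2 := by
    intro k l
    rw [fisher_eq_info, fisherSurr_eq_info, info_apply, info_apply, ← Finset.sum_sub_distrib]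
    simp only [c, Finset.sum_mul, ← Finset.sum_sub_distrib, ← sub_mul]
    refine (Finset.abs_sum_le_sum_abs _ _).trans (Finset.sum_le_sum fun n _ => ?_)
    refine (Finset.abs_sum_le_sum_abs _ _).trans (Finset.sum_le_sum fun j _ => ?_)
    rw [abs_mul, mul_right_comm]
    refine mul_le_mul_of_nonneg_right ?_ (abs_nonneg _)
    refine (abs_yfun_sub_tangent_le T n j _ _).trans (mul_le_mul_of_nonneg_left ?_ (hL n))
    rw [← bits_sub]
    exact pow_le_pow_left₀ (abs_nonneg _) (abs_bits_le _ n j) 2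
  have hsum : ∑ i, ∑ j, |blockMat (aux z) (fisher T z) i j
      - blockMat (aux z) (fisherSurr T x z) i j| ≤ (∑ k, ∑ l, c k l) * ‖z - x‖ ^ 2 := by
    simp only [Fintype.sum_sum_type, blockMat, Matrix.fromBlocks_apply₁₁,
      Matrix.fromBlocks_apply₁₂, Matrix.fromBlocks_apply₂₁, Matrix.fromBlocks_apply₂₂, sub_self,
      abs_zero, Finset.sum_const_zero, zero_add, Finset.sum_mul]
    exact Finset.sum_le_sum fun k _ => Finset.sum_le_sum fun l _ => hentry k l
  rw [abs_le]
  constructor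
  · have := minEig_le_add (blockMat (aux z) (fisherSurr T x z)) (blockMat (aux z) (fisher T z))
    simp only [abs_sub_comm (blockMat (aux z) (fisherSurr T x z) _ _)] at this
    linarith
  · have := minEig_le_add (blockMat (aux z) (fisher T z)) (blockMat (aux z) (fisherSurr T x z))
    linarith

/-! ### The linearised constraints -/

theorem capacity_pos {S : Finset D.Ω} (hS : S.Nonempty) : 0 < capacity D S := by
  refine Real.logb_pos one_lt_two (lt_add_of_pos_right _ (div_pos ?_ D.N₀_pos))
  exact Finset.sum_pos (fun n _ => mul_pos (D.P_pos n) (D.g_pos n)) hS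

/-- The constraint functions with the matrix constraint linearised at `x`, and the capacity
constraints in linear form. -/
noncomputable def conLin (T : KLT D) (x : Var D) : Con D → Var D → ℝ
  | .inl _, z => -minEig (blockMat (aux z) (fisherSurr T x z))
  | .inr (.inl _), z => (aux z).trace - D.ε
  | .inr (.inr S), z => capacityFun .linear S.1 z

theorem capacityFun_linear_combination (S : Finset D.Ω) (x z : Var D) (a b : ℝ) :
    capacityFun .linear S (a • x + b • z) =
      a * capacityFun .linear S x + b * capacityFun .linear S z := by
  simp only [capacityFun, bits_add, bits_smul, uses_add, uses_smul, Finset.sum_add_distrib,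
    ← Finset.mul_sum]
  ring

/-- λ_min is concave and its argument is affine in the variables once the Fisher matrix is replaced
by tangents; the other constraints are affine. -/
theorem conLin_combination_le (T : KLT D) (x z w : Var D) {a b : ℝ} (ha : 0 ≤ a) (hb : 0 ≤ b)
    (hab : a + b = 1) (i : Con D) :
    conLin T x i (a • z + b • w) ≤ a * conLin T x i z + b * conLin T x i w := by
  match i with
  | .inl _ =>
    simp only [conLin]
    have e : blockMat (aux (a • z + b • w)) (fisherSurr T x (a • z + b • w))
        = a • blockMat (aux z) (fisherSurr T x z) + b • blockMat (aux w) (fisherSurr T x w) := by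
      rw [fisherSurr_combination T x z w hab, aux_add, aux_smul, aux_smul]
      simp only [blockMat, Matrix.fromBlocks_smul, Matrix.fromBlocks_add, ← add_smul, hab, one_smul]
    rw [e]
    have := minEig_concave (A := blockMat (aux z) (fisherSurr T x z))
      (B := blockMat (aux w) (fisherSurr T x w)) ha hb
    linarith
  | .inr (.inl _) =>
    simp only [conLin, aux_add, aux_smul, Matrix.trace_add, Matrix.trace_smul, smul_eq_mul]
    refine le_of_eq ?_
    linear_combination D.ε * hab
  | .inr (.inr S) =>
    exact (capacityFun_linear_combination S.1 z w a b).le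

theorem convexOn_conLin (T : KLT D) (x : Var D) (i : Con D) :
    ConvexOn ℝ Set.univ (conLin T x i) :=
  ⟨convex_univ, fun z _ w _ _ _ ha hb hab => conLin_combination_le T x z w ha hb hab i⟩

theorem continuous_capacityFun_linear (S : Finset D.Ω) :
    Continuous (capacityFun (D := D) .linear S) := by
  unfold capacityFun
  refine Continuous.sub ?_ (continuous_uses.mul continuous_const)
  exact continuous_finsetSum _ fun n _ => continuous_finsetSum _ fun j _ => continuous_bits n j

theorem continuous_conLin (T : KLT D) (i : Con D) :
    Continuous fun p : Var D × Var D => conLin T p.1 i p.2 := by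
  match i with
  | .inl _ =>
    refine (continuous_minEig.comp ?_).neg
    exact Continuous.matrix_fromBlocks (continuous_aux.comp continuous_snd) continuous_const
      continuous_const (continuous_fisherSurr T)
  | .inr (.inl _) =>
    exact (Continuous.matrix_trace (continuous_aux.comp continuous_snd)).sub continuous_const
  | .inr (.inr S) => exact (continuous_capacityFun_linear S.1).comp continuous_snd

theorem continuous_conLin_right (T : KLT D) (x : Var D) (i : Con D) :
    Continuous (conLin T x i) :=
  (continuous_conLin T i).comp (Continuous.prodMk_right x)

theorem continuous_conLin_left (T : KLT D) (z : Var D) (i : Con D) :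
    Continuous fun x => conLin T x i z :=
  (continuous_conLin T i).comp (Continuous.prodMk_left z)

theorem continuous_conLin_self (T : KLT D) (i : Con D) : Continuous fun x => conLin T x i x :=
  (continuous_conLin T i).comp (continuous_id.prodMk continuous_id)

/-- Feasibility, with the capacity constraints in linear form. -/
def LinFeasible (T : KLT D) (x : Var D) : Prop := x ∈ domain D ∧ ∀ i, conLin T x i x ≤ 0

/-- No point of the domain decreases the objective and satisfies all linearised constraints
strictly. -/
def IsCritical (T : KLT D) (x : Var D) : Prop :=
  ∀ z ∈ domain D, uses z < uses x → ∃ i, 0 ≤ conLin T x i z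

theorem capacityFun_ratio (S : Finset D.Ω) {x : Var D} (hx : 0 < uses x) :
    capacityFun .ratio S x = capacityFun .linear S x / uses x := by
  simp only [capacityFun, ← Finset.sum_div]
  field_simp

/-- Here a is the proximal term; clearing W from the ratio form multiplies it by W, which accounts
for the margin in `IsMCSCA.uses_le_of_conLin`. -/
theorem capacityFun_add_le_zero_iff (F : CapacityForm) (S : Finset D.Ω) {x : Var D}
    (hx : 0 < uses x) (a : ℝ) :
    capacityFun F S x + a ≤ 0 ↔
      capacityFun .linear S x + (match F with | .ratio => uses x | .linear => 1) * a ≤ 0 := by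
  match F with
  | .linear => simp
  | .ratio =>
    rw [capacityFun_ratio S hx, div_add' _ _ _ hx.ne', div_le_iff₀ hx, zero_mul, mul_comm a]

end Model

/-! ### From critical points to KKT points. -/

section KKT

variable {ι : Type*} {D : Scenario ι}

/-- `uses` as a continuous linear map. -/
noncomputable def usesL : Var D →L[ℝ] ℝ :=
  LinearMap.toContinuousLinearMap
    { toFun := uses, map_add' := uses_add, map_smul' := uses_smul }

/-- The trace of `aux` as a continuous linear map. -/
noncomputable def traceL : Var D →L[ℝ] ℝ :=
  LinearMap.toContinuousLinearMap
    { toFun := fun x => (aux x).trace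
      map_add' := fun x z => by rw [aux_add, Matrix.trace_add]
      map_smul' := fun a x => by rw [aux_smul, Matrix.trace_smul]; rfl }

/-- The linear form of a capacity constraint as a continuous linear map. -/
noncomputable def capacityL (S : Finset D.Ω) : Var D →L[ℝ] ℝ :=
  LinearMap.toContinuousLinearMap
    { toFun := capacityFun .linear S
      map_add' := fun x z => by simpa using capacityFun_linear_combination S x z 1 1
      map_smul' := fun a x => by simpa using capacityFun_linear_combination S x x a 0 }

theorem usesL_apply (x : Var D) : usesL x = uses x := rfl
theorem traceL_apply (x : Var D) : traceL x = (aux x).trace := rfl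
theorem capacityL_apply (S : Finset D.Ω) (x : Var D) :
    capacityL S x = capacityFun .linear S x := rfl

/-- The vector representing a continuous linear functional. -/
noncomputable def rep (f : Var D →L[ℝ] ℝ) : Var D := (InnerProductSpace.toDual ℝ (Var D)).symm f

theorem inner_rep (f : Var D →L[ℝ] ℝ) (w : Var D) : ⟪rep f, w⟫_ℝ = f w :=
  InnerProductSpace.toDual_symm_apply

theorem innerSL_rep (f : Var D →L[ℝ] ℝ) : innerSL ℝ (rep f) = f := by
  ext w
  exact inner_rep f w

/-- The factor by which the two forms of the capacity constraints differ at `x`. -/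
def formScale (F : CapacityForm) (x : Var D) : ℝ :=
  match F with
  | .ratio => uses x
  | .linear => 1

theorem formScale_pos (F : CapacityForm) {x : Var D} (hx : 0 < uses x) : 0 < formScale F x := by
  cases F
  · exact hx
  · exact one_pos

theorem formScale_mul_capacityFun (F : CapacityForm) (S : Finset D.Ω) {x : Var D}
    (hx : 0 < uses x) : formScale F x * capacityFun F S x = capacityFun .linear S x := by
  cases F
  · rw [capacityFun_ratio S hx]
    exact mul_div_cancel₀ _ hx.ne'
  · exact one_mul _

/-- The gradient of the ratio is 1/W times that of the linear form, plus a multiple of the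
constraint value; complementary slackness kills the latter. So multipliers transfer between the
forms by a factor W. -/
theorem exists_mem_subdiff_capacityFun (F : CapacityForm) (S : Finset D.Ω) {x : Var D}
    (hx : 0 < uses x) : ∃ ξ ∈ subdiff (capacityFun F S) x, ∀ l : ℝ,
      l * capacityFun .linear S x = 0 → (formScale F x * l) • ξ = l • rep (capacityL S) := by
  cases F
  · have hd : HasFDerivAt (capacityFun (D := D) .ratio S)
        ((uses x)⁻¹ • capacityL S - (capacityFun .linear S x / uses x ^ 2) • usesL) x := by
      have h1 := (capacityL S).hasFDerivAt (x := x)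
      have h2 := (usesL (D := D)).hasFDerivAt (x := x)
      have h3 := h1.mul ((hasDerivAt_inv hx.ne').comp_hasFDerivAt x h2)
      refine (h3.congr_fderiv ?_).congr_of_eventuallyEq ?_
      · ext w
        simp [capacityL_apply, usesL_apply]
        field_simp
        ring
      · filter_upwards [continuous_uses.continuousAt.eventually (lt_mem_nhds hx)] with z hz
        rw [capacityFun_ratio S hz]
        rfl
    rw [← innerSL_rep ((uses x)⁻¹ • capacityL S
      - (capacityFun .linear S x / uses x ^ 2) • usesL)] at hd
    refine ⟨_, mem_subdiff_of_hasFDerivAt hd, fun l hl => ?_⟩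
    simp only [rep, map_sub, map_smul, formScale, smul_sub, smul_smul]
    rw [show uses x * l * (capacityFun .linear S x / uses x ^ 2)
      = l * capacityFun .linear S x * (uses x / uses x ^ 2) by ring, hl, zero_mul, zero_smul,
      sub_zero, mul_right_comm, mul_inv_cancel₀ hx.ne', one_mul]
  · refine ⟨rep (capacityL S), mem_subdiff_of_hasFDerivAt ?_, fun l _ => ?_⟩
    · rw [innerSL_rep]
      exact (capacityL S).hasFDerivAt
    · simp [formScale]

theorem capacityL_sub (S : Finset D.Ω) (x z : Var D) :
    capacityL S (z - x) = capacityFun .linear S z - capacityFun .linear S x := by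
  rw [map_sub]; rfl

/-- Lagrange multipliers of the linearised problem at a critical point. -/
theorem exists_multipliers_of_isCritical (T : KLT D) {x : Var D} (hx : LinFeasible T x)
    (hcrit : IsCritical T x) {z₀ : Var D} (hz₀ : z₀ ∈ domain D)
    (hslater : ∀ i, conLin T x i z₀ < 0) : ∃ l : Con D → ℝ, (∀ i, 0 ≤ l i) ∧
      (∀ i, l i * conLin T x i x = 0) ∧
      ∀ z ∈ domain D, 0 ≤ uses z - uses x + ∑ i, l i * conLin T x i z := by
  let h : Option (Con D) → Var D → ℝ := fun k z => k.elim (uses z - uses x) fun i => conLin T x i z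
  obtain ⟨lam, hlam, ⟨k, hk⟩, hmin⟩ := exists_fritzJohn_multipliers (h := h) ⟨x, hx.1⟩ (by
    rintro (_ | i)
    · refine ⟨convex_domain, fun z _ w _ a b _ _ hab => le_of_eq ?_⟩
      simp only [h, Option.elim_none, uses_add, uses_smul, smul_eq_mul]
      linear_combination uses x * hab
    · exact (convexOn_conLin T x i).subset (Set.subset_univ _) convex_domain) convex_domain (by
    intro z hz
    by_cases hzx : uses z < uses x
    · obtain ⟨i, hi⟩ := hcrit z hz hzx
      exact ⟨some i, hi⟩
    · exact ⟨none, sub_nonneg.2 (not_lt.1 hzx)⟩)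
  simp only [Fintype.sum_option, h, Option.elim_none, Option.elim_some] at hmin
  -- With a vanishing objective multiplier, the Slater point would make the combination negative.
  have h0 : 0 < lam none := by
    by_contra! hcon
    have hn : lam none = 0 := le_antisymm hcon (hlam none)
    have h1 := hmin z₀ hz₀
    rw [hn, zero_mul, zero_add] at h1
    obtain _ | i := k
    · exact hk.ne' hn
    · refine absurd h1 (not_le.2 (Finset.sum_neg' (fun i _ => ?_) ⟨i, Finset.mem_univ i, ?_⟩))
      · exact mul_nonpos_of_nonneg_of_nonpos (hlam _) (hslater i).le
      · exact mul_neg_of_pos_of_neg hk (hslater i)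
  set l : Con D → ℝ := fun i => lam (some i) / lam none with hl
  have hl0 : ∀ i, 0 ≤ l i := fun i => div_nonneg (hlam _) h0.le
  have hL : ∀ z ∈ domain D, 0 ≤ uses z - uses x + ∑ i, l i * conLin T x i z := by
    intro z hz
    have h1 := div_nonneg (hmin z hz) h0.le
    rw [add_div, mul_div_cancel_left₀ _ h0.ne', Finset.sum_div] at h1
    simpa only [hl, div_mul_eq_mul_div] using h1
  have hcomp : ∀ i, l i * conLin T x i x = 0 := by
    have hnp : ∀ i ∈ Finset.univ, l i * conLin T x i x ≤ 0 := fun i _ =>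
      mul_nonpos_of_nonneg_of_nonpos (hl0 i) (hx.2 i)
    have h1 := hL x hx.1
    rw [sub_self, zero_add] at h1
    have := (Finset.sum_eq_zero_iff_of_nonpos hnp).1 (le_antisymm (Finset.sum_nonpos hnp) h1)
    exact fun i => this i (Finset.mem_univ i)
  exact ⟨l, hl0, hcomp, hL⟩

theorem sum_con {M : Type*} [AddCommMonoid M] (f : Con D → M) :
    ∑ i, f i = f (.inl ()) + (f (.inr (.inl ())) +
      ∑ S : {S : Finset D.Ω // S.Nonempty}, f (.inr (.inr S))) := by
  simp only [Fintype.sum_sum_type, Finset.univ_unique, Finset.sum_singleton]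

/-- Stationarity of the Lagrangian of the linearised problem. -/
theorem exists_subgradient_of_multipliers (T : KLT D) {x : Var D} (hx : x ∈ domain D)
    {l : Con D → ℝ} (hl0 : ∀ i, 0 ≤ l i) (hcomp : ∀ i, l i * conLin T x i x = 0)
    (hL : ∀ z ∈ domain D, 0 ≤ uses z - uses x + ∑ i, l i * conLin T x i z) :
    ∃ ξ₁ : Var D,
      (∀ z, conLin T x (.inl ()) x + ⟪ξ₁, z - x⟫_ℝ ≤ conLin T x (.inl ()) z) ∧
      -(l (.inl ()) • ξ₁ + (rep usesL + l (.inr (.inl ())) • rep traceL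
        + ∑ S : {S : Finset D.Ω // S.Nonempty}, l (.inr (.inr S)) • rep (capacityL S.1)))
        ∈ normalCone (domain D) x := by
  let v : Var D := rep usesL + l (.inr (.inl ())) • rep traceL
    + ∑ S : {S : Finset D.Ω // S.Nonempty}, l (.inr (.inr S)) • rep (capacityL S.1)
  have hv : ∀ w, ⟪v, w⟫_ℝ = usesL w + l (.inr (.inl ())) * traceL w
      + ∑ S : {S : Finset D.Ω // S.Nonempty}, l (.inr (.inr S)) * capacityL S.1 w := by
    intro w
    simp only [v, inner_add_left, sum_inner, real_inner_smul_left, inner_rep]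
  -- Complementary slackness replaces the affine constraints by their linear parts at z - x,
  -- collected in v. Only the matrix constraint remains nonlinear.
  have hstat : ∀ z ∈ domain D, l (.inl ()) * conLin T x (.inl ()) x ≤
      l (.inl ()) * conLin T x (.inl ()) z + ⟪v, z - x⟫_ℝ := by
    intro z hz
    have h1 := hL z hz
    rw [sum_con] at h1
    have h2 := hcomp (.inr (.inl ()))
    have h3 : ∀ S : {S : Finset D.Ω // S.Nonempty},
        l (.inr (.inr S)) * capacityL S.1 (z - x) =
          l (.inr (.inr S)) * conLin T x (.inr (.inr S)) z := by
      intro S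
      have := hcomp (.inr (.inr S))
      rw [capacityL_sub, mul_sub]
      simp only [conLin] at this ⊢
      rw [this, sub_zero]
    rw [hcomp (.inl ()), hv, Finset.sum_congr rfl fun S _ => h3 S, map_sub, map_sub, usesL_apply,
      usesL_apply, traceL_apply, traceL_apply]
    have h4 : conLin T x (.inr (.inl ())) z = (aux z).trace - D.ε := rfl
    have h5 : conLin T x (.inr (.inl ())) x = (aux x).trace - D.ε := rfl
    have h6 : l (.inr (.inl ())) * ((aux z).trace - (aux x).trace) =
        l (.inr (.inl ())) * conLin T x (.inr (.inl ())) z := by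
      rw [h5] at h2
      rw [h4]
      linear_combination -h2
    rw [h6]
    linarith
  have hcont := continuous_conLin_right T x (.inl ())
  obtain ⟨ξ₁, hξ₁, hξ₁'⟩ : ∃ ξ₁ : Var D,
      (∀ z, conLin T x (.inl ()) x + ⟪ξ₁, z - x⟫_ℝ ≤ conLin T x (.inl ()) z) ∧
      ∀ z ∈ domain D, 0 ≤ ⟪l (.inl ()) • ξ₁ + v, z - x⟫_ℝ := by
    -- A zero multiplier leaves the subgradient undetermined, yet a KKT point must exhibit one; the
    -- sum rule over the singleton {x} provides it.
    rcases (hl0 (.inl ())).eq_or_lt with hz | hp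
    · obtain ⟨ξ, hξ, -⟩ := exists_subgradient_of_minimizer (convexOn_conLin T x (.inl ())) hcont
        (convex_singleton x) (Set.mem_singleton x) 0 (by rintro z rfl; simp)
      refine ⟨ξ, hξ, fun z hz' => ?_⟩
      have := hstat z hz'
      rw [← hz, zero_mul, zero_mul, zero_add] at this
      rwa [← hz, zero_smul, zero_add]
    · obtain ⟨ξ, hξ, hξ'⟩ := exists_subgradient_of_minimizer (convexOn_conLin T x (.inl ())) hcont
        convex_domain hx ((l (.inl ()))⁻¹ • v) (fun z hz => by
          have := hstat z hz
          rw [real_inner_smul_left, ← mul_le_mul_iff_right₀ hp, mul_add,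
            mul_inv_cancel_left₀ hp.ne']
          exact this)
      refine ⟨ξ, hξ, fun z hz => ?_⟩
      have := mul_nonneg hp.le (hξ' z hz)
      rwa [← real_inner_smul_left, smul_add, smul_inv_smul₀ hp.ne'] at this
  refine ⟨ξ₁, hξ₁, fun z hz => ?_⟩
  rw [inner_neg_left, neg_nonpos]
  exact hξ₁' z hz

/-- A critical point at which the linearised constraints satisfy Slater's condition is a KKT
point. -/
theorem isKKT_of_isCritical (T : KLT D) (F : CapacityForm) {x : Var D} (hx : LinFeasible T x)
    (hcrit : IsCritical T x) {z₀ : Var D} (hz₀ : z₀ ∈ domain D)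
    (hslater : ∀ i, conLin T x i z₀ < 0) : IsKKT (domain D) uses (con T F) x := by
  have hW : 0 < uses x := hx.1.2.1
  obtain ⟨l, hl0, hcomp, hL⟩ := exists_multipliers_of_isCritical T hx hcrit hz₀ hslater
  obtain ⟨ξ₁, hξ₁, hζ⟩ := exists_subgradient_of_multipliers T hx.1 hl0 hcomp hL
  choose η hη hη' using fun S : {S : Finset D.Ω // S.Nonempty} =>
    exists_mem_subdiff_capacityFun F S.1 hW
  have hcon₁ : ∀ u : Unit, con T F (.inl u) x = conLin T x (.inl ()) x := fun u => by
    simp only [con, conLin, fisherSurr_self]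
  refine ⟨⟨hx.1, ?_⟩, Sum.elim (fun _ => l (.inl ())) (Sum.elim (fun _ => l (.inr (.inl ())))
    fun S => formScale F x * l (.inr (.inr S))), rep usesL,
    Sum.elim (fun _ => ξ₁) (Sum.elim (fun _ => rep traceL) η),
    -(l (.inl ()) • ξ₁ + (rep usesL + l (.inr (.inl ())) • rep traceL
        + ∑ S : {S : Finset D.Ω // S.Nonempty}, l (.inr (.inr S)) • rep (capacityL S.1))),
      ?_, ?_, ?_, ?_, ?_,
    ?_⟩
  · rintro (u | u | S)
    · rw [hcon₁]
      exact hx.2 (.inl ())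
    · exact hx.2 (.inr (.inl ()))
    · have h1 := hx.2 (.inr (.inr S))
      simp only [conLin] at h1
      rw [← formScale_mul_capacityFun F S.1 hW] at h1
      exact nonpos_of_mul_nonpos_right h1 (formScale_pos F hW)
  · rintro (u | u | S)
    · exact hl0 _
    · exact hl0 _
    · exact mul_nonneg (formScale_pos F hW).le (hl0 _)
  · rintro (u | u | S)
    · simp only [Sum.elim_inl]
      rw [hcon₁]
      exact hcomp (.inl ())
    · exact hcomp (.inr (.inl ()))
    · have h1 := hcomp (.inr (.inr S))
      simp only [conLin, Sum.elim_inr, con] at h1 ⊢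
      rw [← formScale_mul_capacityFun F S.1 hW] at h1
      linarith
  · refine mem_subdiff_of_hasFDerivAt ?_
    rw [innerSL_rep]
    exact usesL.hasFDerivAt
  · rintro (u | u | S)
    -- The surrogate agrees with the true constraint at x and differs from it by O(‖z - x‖²), so its
    -- convex subgradient is a Fréchet subgradient of the nonconvex function.
    · obtain ⟨C, -, hC⟩ := exists_abs_minEig_sub_le T
      refine mem_subdiff_of_sq_minorant (h := conLin T x (.inl ())) (C := C)
        (hcon₁ u) (fun z => ?_) hξ₁
      have := (abs_le.1 (hC x z)).2
      simp only [con, conLin]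
      linarith
    · refine mem_subdiff_of_hasFDerivAt ?_
      simp only [Sum.elim_inr, Sum.elim_inl]
      rw [innerSL_rep]
      exact traceL.hasFDerivAt.sub_const _
    · exact hη S
  · exact hζ
  · rw [sum_con]
    simp only [Sum.elim_inl, Sum.elim_inr]
    rw [Finset.sum_congr rfl fun S _ => hη' S (l (.inr (.inr S))) (hcomp (.inr (.inr S)))]
    abel

end KKT

/-! ### Values at KKT points of analytic problems. -/

section KKTValues

open MeasureTheory
open scoped ContDiff

/-- The values of an analytic objective at the KKT points of an analytic problem form a null
set. -/
theorem volume_image_kkt_eq_zero {E K : Type*} [NormedAddCommGroup E] [NormedSpace ℝ E]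
    [FiniteDimensional ℝ E] [Fintype K] {f : E → ℝ} {g : K → E → ℝ} (hf : ContDiff ℝ ω f)
    (hg : ∀ k, ContDiff ℝ ω (g k)) :
    volume (f '' {x | ∃ lam : K → ℝ, (∀ k, 0 ≤ lam k) ∧ (∀ k, lam k * g k x = 0) ∧
      fderiv ℝ f x + ∑ k, lam k • fderiv ℝ (g k) x = 0}) = 0 := by
  -- With multipliers written as squares, stationarity is the vanishing of the x-derivative and
  -- complementary slackness that of the other derivatives; there H equals f.
  let H : E × (K → ℝ) → ℝ := fun p => f p.1 + ∑ k, p.2 k ^ 2 * g k p.1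
  have hH : ContDiff ℝ ω H := by
    refine (hf.comp contDiff_fst).add (ContDiff.sum fun k _ => ?_)
    exact (((contDiff_apply ℝ ℝ k).comp contDiff_snd).pow 2).mul ((hg k).comp contDiff_fst)
  refine measure_mono_null ?_ (volume_image_critical_eq_zero (f := H)
    (s := {p | fderiv ℝ H p = 0}) (fun _ _ => hH.contDiffAt) fun _ h => h)
  rintro _ ⟨x, ⟨lam, hlam, hcomp, hstat⟩, rfl⟩
  have hsq : ∀ k, Real.sqrt (lam k) ^ 2 = lam k := fun k => Real.sq_sqrt (hlam k)
  refine ⟨(x, fun k => Real.sqrt (lam k)), ?_, ?_⟩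
  · have hfd := ((hf.differentiable (by simp)) x).hasFDerivAt
    have hgd := fun k => (((hg k).differentiable (by simp)) x).hasFDerivAt
    set p : E × (K → ℝ) := (x, fun k => Real.sqrt (lam k)) with hp
    have hfst : HasFDerivAt (Prod.fst : E × (K → ℝ) → E) (ContinuousLinearMap.fst ℝ E (K → ℝ)) p :=
      hasFDerivAt_fst
    have hcoord : ∀ k, HasFDerivAt (fun q : E × (K → ℝ) => q.2 k)
        ((ContinuousLinearMap.proj k).comp (ContinuousLinearMap.snd ℝ E (K → ℝ))) p := fun k =>
      ((ContinuousLinearMap.proj k).comp (ContinuousLinearMap.snd ℝ E (K → ℝ))).hasFDerivAt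
    have h1 : HasFDerivAt H _ p := (HasFDerivAt.comp p (by exact hfd) hfst).add
      (HasFDerivAt.fun_sum fun k _ =>
        ((hcoord k).pow 2).mul (HasFDerivAt.comp p (by exact hgd k) hfst))
    change fderiv ℝ H p = 0
    rw [h1.fderiv]
    refine ContinuousLinearMap.ext fun ⟨w, c⟩ => ?_
    have hw := DFunLike.congr_fun hstat w
    have hz : ∀ k, g k x * (2 * Real.sqrt (lam k) * c k) = 0 := fun k => by
      rcases mul_eq_zero.1 (hcomp k) with h | h <;> simp [h]
    simp [hp, hsq] at hw ⊢
    rwa [Finset.sum_congr rfl fun k _ => by rw [hz k, add_zero]]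
  · simp [H, hsq, hcomp]

end KKTValues

/-! ### Schur complements of two-by-two blocks. -/

section TwoByTwo

/-- For small t > 0 the linear term dominates the quadratic one. Applied with the identity
off-diagonal block as the linear term, it makes J strictly positive although G is only semidefinite.
-/
theorem pos_of_forall_quadratic_nonneg {a b c : ℝ} (hb : 0 < b)
    (h : ∀ t : ℝ, 0 ≤ a * t ^ 2 - 2 * b * t + c) : 0 < c := by
  set t := b / (|a| + 1) with ht
  have htp : 0 < t := by positivity
  have h1 : (|a| + 1) * t = b := by rw [ht]; field_simp
  have h2 := h t
  have h3 : a * t ^ 2 ≤ |a| * t ^ 2 := mul_le_mul_of_nonneg_right (le_abs_self a) (sq_nonneg t)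
  nlinarith [mul_pos hb htp]

theorem dotProduct_blockMat_mulVec (M J : Matrix (Fin 2) (Fin 2) ℝ) (u w : Fin 2 → ℝ) :
    Sum.elim u w ⬝ᵥ (blockMat M J *ᵥ Sum.elim u w) =
      M 0 0 * u 0 ^ 2 + (M 0 1 + M 1 0) * (u 0 * u 1) + M 1 1 * u 1 ^ 2
      + 2 * (u 0 * w 0 + u 1 * w 1)
      + J 0 0 * w 0 ^ 2 + (J 0 1 + J 1 0) * (w 0 * w 1) + J 1 1 * w 1 ^ 2 := by
  rw [blockMat, Matrix.fromBlocks_mulVec]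
  simp only [dotProduct, Fintype.sum_sum_type, Fin.sum_univ_two, Sum.elim_inl, Sum.elim_inr,
    Pi.add_apply, Matrix.mulVec, Matrix.one_mulVec, Function.comp_apply]
  ring

/-- Elimination of `M` from the matrix constraint. -/
theorem pos_and_trace_le_of_blockMat {M J : Matrix (Fin 2) (Fin 2) ℝ} (hM : M.IsSymm)
    (hJ : J.IsSymm) (h : 0 ≤ minEig (blockMat M J)) :
    0 < J 0 0 ∧ 0 < J.det ∧ J.trace ≤ M.trace * J.det := by
  have hq : ∀ u w : Fin 2 → ℝ, 0 ≤ Sum.elim u w ⬝ᵥ (blockMat M J *ᵥ Sum.elim u w) := fun u w => by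
    simpa using le_minEig_iff.1 h (Sum.elim u w)
  simp only [dotProduct_blockMat_mulVec] at hq
  have hM' : M 1 0 = M 0 1 := hM.apply 0 1
  have hJ' : J 1 0 = J 0 1 := hJ.apply 0 1
  rw [Matrix.det_fin_two, Matrix.trace_fin_two, Matrix.trace_fin_two]
  simp only [hM', hJ'] at hq ⊢
  set a := M 0 0
  set b := M 0 1
  set d := M 1 1
  set p := J 0 0
  set q := J 0 1
  set r := J 1 1
  have hp : 0 < p := by
    refine pos_of_forall_quadratic_nonneg (a := a) (b := 1) one_pos fun t => ?_
    have := hq ![-t, 0] ![1, 0]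
    simp at this
    linarith
  have hdet : 0 < p * r - q * q := by
    have h1 : 0 < p * (p * r - q * q) := by
      -- The vector w = (q, -p) satisfies wᵀJw = p det J, and u = -t w makes the cross term -2t‖w‖².
      refine pos_of_forall_quadratic_nonneg (a := a * q ^ 2 - 2 * b * (p * q) + d * p ^ 2)
        (b := p ^ 2 + q ^ 2) (by positivity) fun t => ?_
      have := hq ![-t * q, t * p] ![q, -p]
      simp at this
      linarith
    exact pos_of_mul_pos_right h1 hp.le
  refine ⟨hp, hdet, ?_⟩
  -- u = -(det J) eᵢ and w = adj(J) eᵢ: the two forms add up to det J · (tr M · det J - tr J), the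
  -- Schur complement without division.
  have h1 := hq ![-(p * r - q * q), 0] ![r, -q]
  have h2 := hq ![0, -(p * r - q * q)] ![-q, p]
  simp at h1 h2
  have h3 : 0 ≤ (p * r - q * q) * ((a + d) * (p * r - q * q) - (p + r)) := by linarith
  have := nonneg_of_mul_nonneg_right h3 hdet
  linarith

/-- Take M = J⁻¹ + κI, where κ is a quarter of the gap ε - tr J⁻¹, so that tr M = ε - 2κ. -/
theorem exists_blockMat_pos {J : Matrix (Fin 2) (Fin 2) ℝ} {ε : ℝ} (hJ : J.IsSymm)
    (hp : 0 < J 0 0) (hdet : 0 < J.det) (htr : J.trace < ε * J.det) :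
    ∃ M : Matrix (Fin 2) (Fin 2) ℝ, M.IsSymm ∧ M.trace < ε ∧ 0 < minEig (blockMat M J) := by
  have hJ' : J 1 0 = J 0 1 := hJ.apply 0 1
  rw [Matrix.det_fin_two, hJ'] at hdet htr
  rw [Matrix.trace_fin_two] at htr
  set Δ := J 0 0 * J 1 1 - J 0 1 * J 0 1 with hΔ
  have hgap : 0 < ε - (J 0 0 + J 1 1) / Δ := by
    rw [sub_pos, div_lt_iff₀ hdet]
    exact htr
  set κ := (ε - (J 0 0 + J 1 1) / Δ) / 4 with hκ
  have hκ0 : 0 < κ := by positivity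
  refine ⟨!![J 1 1 / Δ + κ, -J 0 1 / Δ; -J 0 1 / Δ, J 0 0 / Δ + κ], ?_, ?_, ?_⟩
  · ext i j
    fin_cases i <;> fin_cases j <;> rfl
  · rw [Matrix.trace_fin_two]
    simp only [Matrix.of_apply, Matrix.cons_val', Matrix.cons_val_zero, Matrix.cons_val_one,
      Matrix.cons_val_fin_one]
    have : J 1 1 / Δ + κ + (J 0 0 / Δ + κ) = ε - 2 * κ := by
      rw [hκ]
      ring
    linarith
  · refine minEig_pos ?_ fun v hv => ?_
    · rw [blockMat, Matrix.isSymm_fromBlocks_iff]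
      refine ⟨?_, by simp, by simp, hJ⟩
      ext i j
      fin_cases i <;> fin_cases j <;> rfl
    · obtain ⟨u, w, rfl⟩ : ∃ u w, v = Sum.elim u w :=
        ⟨v ∘ Sum.inl, v ∘ Sum.inr, (Sum.elim_comp_inl_inr v).symm⟩
      rw [dotProduct_blockMat_mulVec, hJ']
      simp only [Matrix.of_apply, Matrix.cons_val', Matrix.cons_val_zero, Matrix.cons_val_one,
        Matrix.cons_val_fin_one]
      set p := J 0 0
      set q := J 0 1
      set r := J 1 1
      have key : ∀ z₀ z₁ : ℝ, 0 ≤ (r * z₀ ^ 2 - 2 * q * (z₀ * z₁) + p * z₁ ^ 2) / Δ := by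
        intro z₀ z₁
        refine div_nonneg ?_ hdet.le
        have : 0 ≤ p * (r * z₀ ^ 2 - 2 * q * (z₀ * z₁) + p * z₁ ^ 2) := by
          have e : p * (r * z₀ ^ 2 - 2 * q * (z₀ * z₁) + p * z₁ ^ 2)
              = (p * z₁ - q * z₀) ^ 2 + Δ * z₀ ^ 2 := by rw [hΔ]; ring
          rw [e]
          positivity
        exact nonneg_of_mul_nonneg_right this hp
      -- Completing the square: κ‖u‖² + (u + Jw)ᵀ J⁻¹ (u + Jw).
      have e : (r / Δ + κ) * u 0 ^ 2 + (-q / Δ + -q / Δ) * (u 0 * u 1) + (p / Δ + κ) * u 1 ^ 2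
          + 2 * (u 0 * w 0 + u 1 * w 1) + p * w 0 ^ 2 + (q + q) * (w 0 * w 1) + r * w 1 ^ 2
          = κ * (u 0 ^ 2 + u 1 ^ 2) + (r * (u 0 + (p * w 0 + q * w 1)) ^ 2
            - 2 * q * ((u 0 + (p * w 0 + q * w 1)) * (u 1 + (q * w 0 + r * w 1)))
            + p * (u 1 + (q * w 0 + r * w 1)) ^ 2) / Δ := by
        field_simp
        rw [hΔ]
        ring
      rw [e]
      by_cases hu : u 0 = 0 ∧ u 1 = 0
      · rw [hu.1, hu.2]
        have hw : w 0 ≠ 0 ∨ w 1 ≠ 0 := by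
          by_contra! hcon
          apply hv
          ext (i | i) <;> fin_cases i
          · exact hu.1
          · exact hu.2
          · exact hcon.1
          · exact hcon.2
        have e2 : κ * (0 ^ 2 + 0 ^ 2) + (r * (0 + (p * w 0 + q * w 1)) ^ 2
            - 2 * q * ((0 + (p * w 0 + q * w 1)) * (0 + (q * w 0 + r * w 1)))
            + p * (0 + (q * w 0 + r * w 1)) ^ 2) / Δ
            = ((p * w 0 + q * w 1) ^ 2 + Δ * w 1 ^ 2) / p := by
          field_simp
          rw [hΔ]
          ring
        rw [e2]
        refine div_pos ?_ hp
        by_cases h1 : w 1 = 0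
        · have h0 : w 0 ≠ 0 := hw.resolve_right (not_not.2 h1)
          rw [h1]
          have : 0 < (p * w 0) ^ 2 := by positivity
          nlinarith
        · positivity
      · have h1 : 0 < u 0 ^ 2 + u 1 ^ 2 := by
          by_cases h0 : u 0 = 0
          · have h1 : u 1 ≠ 0 := fun h1 => hu ⟨h0, h1⟩
            positivity
          · positivity
        have := key (u 0 + (p * w 0 + q * w 1)) (u 1 + (q * w 0 + r * w 1))
        have := mul_pos hκ0 h1
        linarith

end TwoByTwo

/-! ### The problem with M eliminated. -/

section Reduced

open scoped ContDiff

variable {ι : Type*} {D : Scenario ι}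

/-- The accuracy constraint `tr J - ε det J ≤ 0`, which for `J ≻ 0` means `tr J⁻¹ ≤ ε`. -/
noncomputable def accuracy (T : KLT D) (x : Var D) : ℝ :=
  (fisher T x).trace - D.ε * (fisher T x).det

/-- `bits` as a continuous linear map. -/
noncomputable def bitsL (n : D.Ω) (j : D.Idx n) : Var D →L[ℝ] ℝ :=
  LinearMap.toContinuousLinearMap
    { toFun := fun x => bits x n j
      map_add' := fun x z => bits_add x z n j
      map_smul' := fun a x => bits_smul a x n j }

theorem bitsL_apply (n : D.Ω) (j : D.Idx n) (x : Var D) : bitsL n j x = bits x n j := rfl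

/-- The derivative of `fisher` at `x`. -/
noncomputable def fisherSlope (T : KLT D) (x w : Var D) : Matrix (Fin 2) (Fin 2) ℝ :=
  info T fun n j => ySlope T n j (bits x n j) * bits w n j

/-- The sensitivity of `accuracy` to `y_{nj}`. -/
noncomputable def sensitivity (T : KLT D) (x : Var D) (n : D.Ω) (j : D.Idx n) : ℝ :=
  col T n j 0 ^ 2 + col T n j 1 ^ 2 - D.ε * (fisher T x 1 1 * col T n j 0 ^ 2
    + fisher T x 0 0 * col T n j 1 ^ 2 - 2 * fisher T x 0 1 * (col T n j 0 * col T n j 1))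

/-- The derivative of `accuracy` at `x`. -/
noncomputable def accuracyL (T : KLT D) (x : Var D) : Var D →L[ℝ] ℝ :=
  ∑ n, ∑ j, (ySlope T n j (bits x n j) * sensitivity T x n j) • bitsL n j

theorem accuracyL_apply (T : KLT D) (x w : Var D) :
    accuracyL T x w = ∑ n, ∑ j, ySlope T n j (bits x n j) * sensitivity T x n j * bits w n j := by
  simp [accuracyL, bitsL_apply]

theorem fisher_isSymm (T : KLT D) (x : Var D) : (fisher T x).IsSymm := by
  rw [fisher_eq_info]
  exact info_isSymm T _

theorem fisherSurr_isSymm (T : KLT D) (x z : Var D) : (fisherSurr T x z).IsSymm :=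
  info_isSymm T _

theorem fisherSlope_isSymm (T : KLT D) (x w : Var D) : (fisherSlope T x w).IsSymm :=
  info_isSymm T _

theorem accuracyL_eq (T : KLT D) (x w : Var D) :
    accuracyL T x w = (fisherSlope T x w).trace - D.ε *
      (fisher T x 0 0 * fisherSlope T x w 1 1 + fisherSlope T x w 0 0 * fisher T x 1 1
        - 2 * fisher T x 0 1 * fisherSlope T x w 0 1) := by
  rw [accuracyL_apply, Matrix.trace_fin_two]
  simp only [fisherSlope, info_apply, Finset.mul_sum, Finset.sum_mul, ← Finset.sum_add_distrib,
    ← Finset.sum_sub_distrib]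
  refine Finset.sum_congr rfl fun n _ => Finset.sum_congr rfl fun j _ => ?_
  rw [sensitivity]
  ring

theorem fisherSurr_eq_add (T : KLT D) (x z : Var D) :
    fisherSurr T x z = fisher T x + fisherSlope T x (z - x) := by
  rw [fisherSurr_eq_info, fisher_eq_info, fisherSlope]
  have := info_combination T (fun n j => yfun T n j (bits x n j))
    (fun n j => ySlope T n j (bits x n j) * bits (z - x) n j) 1 1
  simp only [one_smul, one_mul] at this
  rw [← this]
  congr 1
  ext n j
  rw [tangent, deriv_yfun, bits_sub]
  ring

theorem contDiff_fisher_apply (T : KLT D) (k l : Fin 2) :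
    ContDiff ℝ ω fun x : Var D => fisher T x k l := by
  simp only [fisher_eq_info, info_apply]
  refine ContDiff.sum fun n _ => ContDiff.sum fun j _ => ?_
  exact ((contDiff_yfun T n j).comp (bitsL n j).contDiff).mul contDiff_const

theorem contDiff_accuracy (T : KLT D) : ContDiff ℝ ω (accuracy T) := by
  have := contDiff_fisher_apply T
  unfold accuracy
  simp only [Matrix.trace_fin_two, Matrix.det_fin_two]
  exact ((this 0 0).add (this 1 1)).sub
    (contDiff_const.mul (((this 0 0).mul (this 1 1)).sub ((this 0 1).mul (this 1 0))))

theorem hasFDerivAt_fisher_apply (T : KLT D) (x : Var D) (k l : Fin 2) :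
    HasFDerivAt (fun x : Var D => fisher T x k l)
      (∑ n, ∑ j, (col T n j k * col T n j l) • ySlope T n j (bits x n j) • bitsL n j) x := by
  simp only [fisher_eq_info, info_apply]
  refine HasFDerivAt.fun_sum fun n _ => HasFDerivAt.fun_sum fun j _ => ?_
  exact HasFDerivAt.mul_const
    ((hasDerivAt_yfun T n j (bits x n j)).comp_hasFDerivAt x (bitsL n j).hasFDerivAt) _

theorem hasFDerivAt_accuracy (T : KLT D) (x : Var D) :
    HasFDerivAt (accuracy T) (accuracyL T x) x := by
  have h := hasFDerivAt_fisher_apply T x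
  have e : accuracy T = fun x => fisher T x 0 0 + fisher T x 1 1 -
      D.ε * (fisher T x 0 0 * fisher T x 1 1 - fisher T x 0 1 * fisher T x 1 0) := by
    ext x
    rw [accuracy, Matrix.trace_fin_two, Matrix.det_fin_two]
  rw [e]
  refine (((h 0 0).add (h 1 1)).sub ((((h 0 0).mul (h 1 1)).sub
    ((h 0 1).mul (h 1 0))).const_mul D.ε)).congr_fderiv ?_
  have hslope : ∀ k l w, (∑ n, ∑ j, (col T n j k * col T n j l) •
      ySlope T n j (bits x n j) • bitsL n j : Var D →L[ℝ] ℝ) w = fisherSlope T x w k l := by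
    intro k l w
    simp only [sum_apply, fisherSlope, info_apply]
    refine Finset.sum_congr rfl fun n _ => Finset.sum_congr rfl fun j _ => ?_
    simp only [smul_apply, bitsL_apply, smul_eq_mul]
    ring
  refine ContinuousLinearMap.ext fun w => ?_
  simp only [sub_apply, add_apply,
    smul_apply, hslope, smul_eq_mul]
  rw [accuracyL_eq, Matrix.trace_fin_two, (fisher_isSymm T x).apply 0 1,
    (fisherSlope_isSymm T x w).apply 0 1]
  ring

theorem fisher_pos_of_linFeasible (T : KLT D) {x : Var D} (hx : LinFeasible T x) :
    0 < fisher T x 0 0 ∧ 0 < (fisher T x).det ∧ accuracy T x ≤ 0 := by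
  have h1 := hx.2 (.inl ())
  have h2 := hx.2 (.inr (.inl ()))
  simp only [conLin, fisherSurr_self, neg_nonpos] at h1 h2
  obtain ⟨h3, h4, h5⟩ := pos_and_trace_le_of_blockMat hx.1.2.2 (fisher_isSymm T x) h1
  refine ⟨h3, h4, ?_⟩
  have := mul_le_mul_of_nonneg_right (sub_nonpos.1 h2) h4.le
  rw [accuracy]
  linarith

/-- Replace `M`. -/
noncomputable def setAux (x : Var D) (M : Matrix (Fin 2) (Fin 2) ℝ) : Var D :=
  WithLp.toLp 2 (Sum.elim (fun q => x (.inl q)) (Sum.elim (fun u => x (.inr (.inl u)))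
    fun p => M p.1 p.2))

theorem uses_setAux (x : Var D) (M : Matrix (Fin 2) (Fin 2) ℝ) : uses (setAux x M) = uses x := rfl

theorem aux_setAux (x : Var D) (M : Matrix (Fin 2) (Fin 2) ℝ) : aux (setAux x M) = M := rfl

/-- At a critical point, the problem with `M` eliminated and the accuracy constraint linearised
has no strictly feasible descent. -/
theorem accuracy_linearization_nonneg (T : KLT D) {x : Var D} (hx : LinFeasible T x)
    (hcrit : IsCritical T x) {z : Var D} (hz : z ∈ domain D) (hzx : uses z < uses x)
    (hcap : ∀ S : Finset D.Ω, S.Nonempty → capacityFun .linear S z < 0) :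
    0 ≤ accuracy T x + accuracyL T x (z - x) := by
  by_contra! hneg
  obtain ⟨hp, hdet, hacc⟩ := fisher_pos_of_linFeasible T hx
  set A := fisher T x with hA
  set P := fisherSlope T x (z - x) with hP
  have hP01 : P 1 0 = P 0 1 := (fisherSlope_isSymm T x _).apply 0 1
  have hA01 : A 1 0 = A 0 1 := (fisher_isSymm T x).apply 0 1
  -- The surrogate Fisher matrix along the segment from x to z.
  let B : ℝ → Matrix (Fin 2) (Fin 2) ℝ := fun s => A + s • P
  have hBdet : ∀ s, (B s).det = A.det + s * (A 0 0 * P 1 1 + P 0 0 * A 1 1 - 2 * A 0 1 * P 0 1)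
      + s ^ 2 * P.det := by
    intro s
    simp only [B, Matrix.det_fin_two, Matrix.add_apply, Matrix.smul_apply, smul_eq_mul, hP01, hA01]
    ring
  have hBacc : ∀ s, (B s).trace - D.ε * (B s).det
      = accuracy T x + s * accuracyL T x (z - x) - s ^ 2 * (D.ε * P.det) := by
    intro s
    rw [hBdet, accuracyL_eq, accuracy]
    simp only [B, Matrix.trace_add, Matrix.trace_smul, smul_eq_mul]
    ring
  have hev : ∀ᶠ s in 𝓝[>] (0 : ℝ), 0 < s ∧ s < 1 ∧ 0 < B s 0 0 ∧ 0 < (B s).det ∧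
      accuracy T x + accuracyL T x (z - x) - s * (D.ε * P.det) < 0 := by
    have h1 : Continuous fun s : ℝ => B s 0 0 := by
      simp only [B, Matrix.add_apply, Matrix.smul_apply, smul_eq_mul]
      fun_prop
    have h2 : Continuous fun s : ℝ => (B s).det := by
      simp only [hBdet]
      fun_prop
    have h3 : Continuous fun s : ℝ =>
        accuracy T x + accuracyL T x (z - x) - s * (D.ε * P.det) := by fun_prop
    have l1 : ∀ᶠ s in 𝓝 (0 : ℝ), 0 < B s 0 0 :=
      continuousAt_const.eventually_lt h1.continuousAt (by simpa [B] using hp)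
    have l2 : ∀ᶠ s in 𝓝 (0 : ℝ), 0 < (B s).det :=
      continuousAt_const.eventually_lt h2.continuousAt (by simpa [B] using hdet)
    have l3 := h3.continuousAt.eventually_lt (x₀ := 0) continuousAt_const (by simpa using hneg)
    have l4 : ∀ᶠ s in 𝓝 (0 : ℝ), s < 1 := eventually_lt_nhds one_pos
    filter_upwards [self_mem_nhdsWithin, mem_nhdsWithin_of_mem_nhds l1,
      mem_nhdsWithin_of_mem_nhds l2, mem_nhdsWithin_of_mem_nhds l3,
      mem_nhdsWithin_of_mem_nhds l4] with s a b c d e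
    exact ⟨a, e, b, c, d⟩
  obtain ⟨s, hs0, hs1, hB0, hBd, hBs⟩ := hev.exists
  have hsurr : B s = fisherSurr T x ((1 - s) • x + s • z) := by
    rw [fisherSurr_combination T x x z (by ring), fisherSurr_self, fisherSurr_eq_add]
    simp only [B]
    module
  have hBsymm : (B s).IsSymm := by
    rw [hsurr]
    exact fisherSurr_isSymm T x _
  -- tr B - ε det B equals (1 - s) times the accuracy at x plus s times its linearisation, up to s²ε
  -- det P. For small s it is negative, so a strictly feasible M exists, and with it a point that
  -- refutes criticality.
  obtain ⟨M, hM1, hM2, hM3⟩ := exists_blockMat_pos (ε := D.ε) hBsymm hB0 hBd (by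
    have h1 := hBacc s
    have h2 := mul_neg_of_pos_of_neg hs0 hBs
    have h3 := mul_nonpos_of_nonneg_of_nonpos (sub_nonneg.2 hs1.le) hacc
    nlinarith)
  set w := (1 - s) • x + s • z with hw
  have hwdom : w ∈ domain D := convex_domain hx.1 hz (by linarith) hs0.le (by ring)
  obtain ⟨i, hi⟩ := hcrit (setAux w M) ⟨hwdom.1, hwdom.2.1, hM1⟩ (by
    rw [uses_setAux, hw, uses_add, uses_smul, uses_smul]
    nlinarith)
  refine absurd hi (not_le.2 ?_)
  match i with
  | .inl _ =>
    have e : fisherSurr T x (setAux w M) = B s := hsurr.symm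
    simp only [conLin, aux_setAux, e]
    linarith
  | .inr (.inl _) =>
    simp only [conLin, aux_setAux]
    linarith
  | .inr (.inr S) =>
    have h1 := hx.2 (.inr (.inr S))
    have h2 := hcap S.1 S.2
    have e : capacityFun .linear S.1 (setAux w M) = capacityFun .linear S.1 w := rfl
    simp only [conLin] at h1 ⊢
    rw [e, hw, capacityFun_linear_combination]
    have h3 := mul_nonpos_of_nonneg_of_nonpos (sub_nonneg.2 hs1.le) h1
    have h4 := mul_neg_of_pos_of_neg hs0 h2
    linarith

/-- More bits improve the accuracy. -/
theorem sensitivity_nonpos (T : KLT D) {x : Var D} (hx : LinFeasible T x) (n : D.Ω)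
    (j : D.Idx n) : sensitivity T x n j ≤ 0 ∧
      (sensitivity T x n j = 0 → ∀ k, col T n j k = 0) := by
  obtain ⟨hp, hdet, hacc⟩ := fisher_pos_of_linFeasible T hx
  rw [accuracy, Matrix.trace_fin_two] at hacc
  rw [Matrix.det_fin_two, (fisher_isSymm T x).apply 0 1] at hdet hacc
  rw [sensitivity]
  set p := fisher T x 0 0
  set q := fisher T x 0 1
  set r := fisher T x 1 1
  set a := col T n j 0
  set b := col T n j 1
  set Q := r * a ^ 2 + p * b ^ 2 - 2 * q * (a * b) with hQ
  have hQ0 : 0 ≤ Q := by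
    have : 0 ≤ p * Q := by
      have e : p * Q = (p * b - q * a) ^ 2 + (p * r - q * q) * a ^ 2 := by rw [hQ]; ring
      rw [e]
      positivity
    exact nonneg_of_mul_nonneg_right this hp
  -- With v = (a, b) and Q = vᵀ adj(J) v, Cayley–Hamilton for adj(J) gives det J ‖v‖² - tr J · Q =
  -- -‖adj(J) v‖²; feasibility gives ε det J ≥ tr J.
  have key : (p * r - q * q) * (a ^ 2 + b ^ 2 - D.ε * Q) ≤
      -((r * a - q * b) ^ 2 + (p * b - q * a) ^ 2) := by
    have h1 := mul_nonneg (sub_nonneg.2 (sub_nonpos.1 hacc)) hQ0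
    have e : (p * r - q * q) * (a ^ 2 + b ^ 2) - (p + r) * Q
        = -((r * a - q * b) ^ 2 + (p * b - q * a) ^ 2) := by rw [hQ]; ring
    nlinarith
  constructor
  · by_contra! hcon
    nlinarith [mul_pos hdet hcon, sq_nonneg (r * a - q * b), sq_nonneg (p * b - q * a)]
  · intro h0
    rw [h0, mul_zero] at key
    have h1 : r * a - q * b = 0 := by
      nlinarith [sq_nonneg (r * a - q * b), sq_nonneg (p * b - q * a)]
    have h2 : p * b - q * a = 0 := by
      nlinarith [sq_nonneg (r * a - q * b), sq_nonneg (p * b - q * a)]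
    have ha : a = 0 := by
      have : (p * r - q * q) * a = 0 := by linear_combination p * h1 + q * h2
      exact (mul_eq_zero.1 this).resolve_left hdet.ne'
    have hb : b = 0 := by
      rw [ha] at h2
      have : p * b = 0 := by linarith
      exact (mul_eq_zero.1 this).resolve_left hp.ne'
    intro k
    fin_cases k
    · exact ha
    · exact hb

/-- If every sensitivity vanished, all columns would vanish and J would be 0, against J 0 0 > 0.
This gives the reduced problem its constraint qualification. -/
theorem accuracyL_neg (T : KLT D) {x : Var D} (hx : LinFeasible T x) {w : Var D}
    (hw : ∀ n j, bits w n j = 1) : accuracyL T x w < 0 := by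
  obtain ⟨hp, -, -⟩ := fisher_pos_of_linFeasible T hx
  rw [accuracyL_apply]
  simp only [hw, mul_one]
  have hle : ∀ n j, ySlope T n j (bits x n j) * sensitivity T x n j ≤ 0 := fun n j =>
    mul_nonpos_of_nonneg_of_nonpos (ySlope_pos T n j _).le (sensitivity_nonpos T hx n j).1
  have hle' : ∀ n : D.Ω, ∑ j, ySlope T n j (bits x n j) * sensitivity T x n j ≤ 0 := fun n =>
    Finset.sum_nonpos fun j _ => hle n j
  refine lt_of_le_of_ne (Finset.sum_nonpos fun n _ => hle' n) fun h0 => hp.ne' ?_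
  rw [Finset.sum_eq_zero_iff_of_nonpos fun n _ => hle' n] at h0
  rw [fisher_eq_info, info_apply]
  refine Finset.sum_eq_zero fun n hn => Finset.sum_eq_zero fun j hj => ?_
  have h1 := (Finset.sum_eq_zero_iff_of_nonpos fun j _ => hle n j).1 (h0 n hn) j hj
  have h2 := (mul_eq_zero.1 h1).resolve_left (ySlope_pos T n j _).ne'
  rw [(sensitivity_nonpos T hx n j).2 h2 0, zero_mul, mul_zero]

end Reduced

/-! ### The critical values form a null set. -/

section CriticalValues

open MeasureTheory
open scoped ContDiff

variable {ι : Type*} {D : Scenario ι}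

/-- Fritz John multipliers of the problem with `M` eliminated; that of the objective is positive. -/
theorem exists_reduced_multipliers (T : KLT D) {x : Var D} (hx : LinFeasible T x)
    (hcrit : IsCritical T x) : ∃ (a : ℝ) (b : {S : Finset D.Ω // S.Nonempty} → ℝ),
      0 ≤ a ∧ (∀ S, 0 ≤ b S) ∧ a * accuracy T x = 0 ∧
      (∀ S, b S * capacityFun .linear S.1 x = 0) ∧
      ∀ z ∈ domain D, 0 ≤ usesL (z - x) + a * accuracyL T x (z - x)
        + ∑ S, b S * capacityL S.1 (z - x) := by
  obtain ⟨-, -, hacc⟩ := fisher_pos_of_linFeasible T hx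
  have hcapx : ∀ S : {S : Finset D.Ω // S.Nonempty}, capacityFun .linear S.1 x ≤ 0 := fun S => by
    have := hx.2 (.inr (.inr S))
    simpa only [conLin] using this
  let h : Option (Option {S : Finset D.Ω // S.Nonempty}) → Var D → ℝ := fun k z =>
    k.elim (uses z - uses x) fun k => k.elim (accuracy T x + accuracyL T x (z - x))
      fun S => capacityFun .linear S.1 z
  obtain ⟨lam, hlam, ⟨k, hk⟩, hmin⟩ := exists_fritzJohn_multipliers (h := h) ⟨x, hx.1⟩ (by
    rintro (_ | _ | S) <;> refine ⟨convex_domain, fun z _ w _ a b _ _ hab => le_of_eq ?_⟩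
    · simp only [h, Option.elim_none, uses_add, uses_smul, smul_eq_mul]
      linear_combination uses x * hab
    · simp only [h, Option.elim_none, Option.elim_some, map_sub, map_add, map_smul, smul_eq_mul]
      linear_combination (accuracyL T x x - accuracy T x) * hab
    · simp only [h, Option.elim_some, smul_eq_mul]
      exact capacityFun_linear_combination S.1 z w a b) convex_domain (by
    intro z hz
    by_contra! hcon
    have h1 := hcon none
    have h2 := hcon (some none)
    have h3 := fun S => hcon (some (some S))
    simp only [h, Option.elim_none, Option.elim_some] at h1 h2 h3
    exact absurd (accuracy_linearization_nonneg T hx hcrit hz (sub_neg.1 h1)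
      fun S hS => h3 ⟨S, hS⟩) (not_le.2 h2))
  simp only [Fintype.sum_option, h, Option.elim_none, Option.elim_some] at hmin
  -- No Slater point is assumed: one more bit in every coordinate makes the linearised accuracy
  -- strict, and a large W makes all capacities strict. M no longer occurs in the constraints.
  have h0 : 0 < lam none := by
    by_contra! hcon
    have hn : lam none = 0 := le_antisymm hcon (hlam none)
    let tot : ℝ := ∑ S : {S : Finset D.Ω // S.Nonempty},
      (∑ n ∈ S.1, ∑ j : D.Idx n, (bits x n j + 1) + 1) / capacity D S.1
    have hterm : ∀ S : {S : Finset D.Ω // S.Nonempty},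
        0 < (∑ n ∈ S.1, ∑ j : D.Idx n, (bits x n j + 1) + 1) / capacity D S.1 := fun S => by
      refine div_pos ?_ (capacity_pos S.2)
      have : 0 ≤ ∑ n ∈ S.1, ∑ j : D.Idx n, (bits x n j + 1) :=
        Finset.sum_nonneg fun n _ => Finset.sum_nonneg fun j _ => by
          have := hx.1.1 n j
          linarith
      linarith
    let z : Var D := WithLp.toLp 2 (Sum.elim (fun q => bits x q.1 q.2 + 1)
      (Sum.elim (fun _ => tot + 1) fun p => aux x p.1 p.2))
    have hbits : ∀ n j, bits z n j = bits x n j + 1 := fun _ _ => rfl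
    have huses : uses z = tot + 1 := rfl
    have htot : 0 ≤ tot := Finset.sum_nonneg fun S _ => (hterm S).le
    have hz : z ∈ domain D := by
      refine ⟨fun n j => ?_, ?_, hx.1.2.2⟩
      · rw [hbits]
        have := hx.1.1 n j
        linarith
      · rw [huses]
        linarith
    have hcap : ∀ S : {S : Finset D.Ω // S.Nonempty}, capacityFun .linear S.1 z < 0 := by
      intro S
      simp only [capacityFun, hbits, huses]
      have h1 : (∑ n ∈ S.1, ∑ j : D.Idx n, (bits x n j + 1) + 1) / capacity D S.1 ≤ tot :=
        Finset.single_le_sum (f := fun S : {S : Finset D.Ω // S.Nonempty} =>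
          (∑ n ∈ S.1, ∑ j : D.Idx n, (bits x n j + 1) + 1) / capacity D S.1)
          (fun S _ => (hterm S).le) (Finset.mem_univ S)
      have hC := capacity_pos S.2
      rw [div_le_iff₀ hC] at h1
      nlinarith
    have hlin : accuracy T x + accuracyL T x (z - x) < 0 := by
      have := accuracyL_neg T hx (w := z - x) fun n j => by rw [bits_sub, hbits]; ring
      linarith
    have h1 := hmin z hz
    rw [hn, zero_mul, zero_add] at h1
    have h2 : lam (some none) * (accuracy T x + accuracyL T x (z - x)) ≤ 0 :=
      mul_nonpos_of_nonneg_of_nonpos (hlam _) hlin.le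
    have h3 : ∀ S ∈ Finset.univ, lam (some (some S)) * capacityFun .linear S.1 z ≤ 0 :=
      fun S _ => mul_nonpos_of_nonneg_of_nonpos (hlam _) (hcap S).le
    have h4 := Finset.sum_nonpos h3
    match k with
    | none => exact hk.ne' hn
    | some none =>
      have := mul_neg_of_pos_of_neg hk hlin
      linarith
    | some (some S) =>
      have := Finset.sum_neg' h3 ⟨S, Finset.mem_univ S, mul_neg_of_pos_of_neg hk (hcap S)⟩
      linarith
  set a := lam (some none) / lam none with ha
  set b : {S : Finset D.Ω // S.Nonempty} → ℝ := fun S => lam (some (some S)) / lam none with hb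
  have ha0 : 0 ≤ a := div_nonneg (hlam _) h0.le
  have hb0 : ∀ S, 0 ≤ b S := fun S => div_nonneg (hlam _) h0.le
  have hL : ∀ z ∈ domain D, 0 ≤ uses z - uses x + (a * (accuracy T x + accuracyL T x (z - x))
      + ∑ S, b S * capacityFun .linear S.1 z) := by
    intro z hz
    have h1 := div_nonneg (hmin z hz) h0.le
    rw [add_div, mul_div_cancel_left₀ _ h0.ne', add_div, Finset.sum_div] at h1
    simpa only [ha, hb, div_mul_eq_mul_div] using h1
  have hx0 := hL x hx.1
  rw [sub_self, sub_self, map_zero, add_zero, zero_add] at hx0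
  have hnp : ∀ S ∈ Finset.univ, b S * capacityFun .linear S.1 x ≤ 0 := fun S _ =>
    mul_nonpos_of_nonneg_of_nonpos (hb0 S) (hcapx S)
  have ha1 := mul_nonpos_of_nonneg_of_nonpos ha0 hacc
  have hb1 := Finset.sum_nonpos hnp
  have ha2 : a * accuracy T x = 0 := by linarith
  have hb2 : ∀ S, b S * capacityFun .linear S.1 x = 0 := fun S =>
    (Finset.sum_eq_zero_iff_of_nonpos hnp).1 (by linarith) S (Finset.mem_univ S)
  refine ⟨a, b, ha0, hb0, ha2, hb2, fun z hz => ?_⟩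
  have h1 := hL z hz
  rw [mul_add, ha2, zero_add, ← add_assoc] at h1
  rw [Finset.sum_congr rfl fun S _ => show b S * capacityL S.1 (z - x)
    = b S * capacityFun .linear S.1 z by rw [capacityL_sub, mul_sub, hb2 S, sub_zero]]
  exact h1

/-- A linear functional that is nonnegative on the feasible directions at `x` and does not involve
`M` is a nonnegative combination of the active coordinates `bits`. -/
theorem eq_sum_bits_of_nonneg_on_domain {x : Var D} (hx : x ∈ domain D) {f : Var D →L[ℝ] ℝ}
    (hf : ∀ z ∈ domain D, 0 ≤ f (z - x))
    (haux : ∀ w, (∀ n j, bits w n j = 0) → uses w = 0 → f w = 0) :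
    ∃ ν : (n : D.Ω) × D.Idx n → ℝ, (∀ q, 0 ≤ ν q) ∧ (∀ q, ν q * bits x q.1 q.2 = 0) ∧
      f = ∑ q, ν q • bitsL q.1 q.2 := by
  classical
  let e : Coord D → Var D := fun c => EuclideanSpace.single c 1
  have hbits : ∀ (q : (n : D.Ω) × D.Idx n) n j,
      bits (e (.inl q)) n j = if (⟨n, j⟩ : (n : D.Ω) × D.Idx n) = q then 1 else 0 := by
    intro q n j
    simp [e, bits, PiLp.single_apply]
  have huses : ∀ q, uses (e (.inl q)) = 0 := fun q => by
    simp [e, uses]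
  have hauxq : ∀ q, aux (e (.inl q)) = 0 := fun q => by
    ext i k
    simp [e, aux]
  have hmem : ∀ q (t : ℝ), -bits x q.1 q.2 ≤ t → x + t • e (.inl q) ∈ domain D := by
    intro q t ht
    refine ⟨fun n j => ?_, ?_, ?_⟩
    · rw [bits_add, bits_smul, hbits]
      split_ifs with h
      · subst h
        simp only [mul_one]
        linarith
      · simpa using hx.1 n j
    · rw [uses_add, uses_smul, huses, mul_zero, add_zero]
      exact hx.2.1
    · rw [aux_add, aux_smul, hauxq, smul_zero, add_zero]
      exact hx.2.2
  have hν : ∀ q, 0 ≤ f (e (.inl q)) := fun q => by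
    have := hf _ (hmem q 1 (by have := hx.1 q.1 q.2; linarith))
    simpa using this
  -- W > 0 is an open condition, so W can move in both directions.
  have hW : f (e (.inr (.inl ()))) = 0 := by
    have hmemW : ∀ t : ℝ, -uses x < t → x + t • e (.inr (.inl ())) ∈ domain D := by
      intro t ht
      have h1 : ∀ n j, bits (e (.inr (.inl ()))) n j = 0 := fun n j => by
        simp [e, bits]
      have h2 : uses (e (.inr (.inl ()))) = 1 := by
        simp [e, uses]
      have h3 : aux (e (.inr (.inl ()))) = 0 := by
        ext i k
        simp [e, aux]
      refine ⟨fun n j => ?_, ?_, ?_⟩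
      · rw [bits_add, bits_smul, h1, mul_zero, add_zero]
        exact hx.1 n j
      · rw [uses_add, uses_smul, h2]
        linarith
      · rw [aux_add, aux_smul, h3, smul_zero, add_zero]
        exact hx.2.2
    have hpos := hx.2.1
    have h1 := hf _ (hmemW 1 (by linarith))
    have h2 := hf _ (hmemW (-(uses x / 2)) (by linarith))
    simp only [add_sub_cancel_left, map_smul, smul_eq_mul, one_mul] at h1 h2
    nlinarith
  -- A single off-diagonal entry of M leaves the symmetric matrices, so feasible directions do not
  -- settle these coordinates.
  have hM : ∀ p, f (e (.inr (.inr p))) = 0 := fun p => haux _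
    (fun n j => by simp [e, bits])
    (by simp [e, uses])
  refine ⟨fun q => f (e (.inl q)), hν, fun q => ?_, ?_⟩
  · have h1 := hf _ (hmem q _ le_rfl)
    simp only [add_sub_cancel_left, map_smul, smul_eq_mul] at h1
    have h2 := mul_nonneg (hν q) (hx.1 q.1 q.2)
    linarith
  · refine ContinuousLinearMap.ext fun w => ?_
    have hw : w = ∑ c, w c • e c := by
      simpa [e] using ((EuclideanSpace.basisFun (Coord D) ℝ).sum_repr w).symm
    conv_lhs => rw [hw]
    rw [map_sum, Fintype.sum_sum_type, Fintype.sum_sum_type]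
    simp only [map_smul, hM, Finset.univ_unique, Finset.sum_singleton, sum_apply,
      smul_apply, bitsL_apply, smul_eq_mul]
    rw [show f (e (.inr (.inl default))) = 0 from hW]
    simp only [mul_zero, Finset.sum_const_zero, add_zero]
    exact Finset.sum_congr rfl fun q _ => mul_comm _ _

/-- The critical values form a null set. -/
theorem volume_criticalValues_eq_zero (T : KLT D) :
    volume (uses '' {x : Var D | LinFeasible T x ∧ IsCritical T x}) = 0 := by
  let g : Unit ⊕ {S : Finset D.Ω // S.Nonempty} ⊕ ((n : D.Ω) × D.Idx n) → Var D → ℝ :=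
    Sum.elim (fun _ => accuracy T) (Sum.elim (fun S => capacityL S.1) fun q => -bitsL q.1 q.2)
  have hg : ∀ k, ContDiff ℝ ω (g k) := by
    rintro (_ | S | q)
    · exact contDiff_accuracy T
    · exact (capacityL S.1).contDiff
    · exact (-bitsL q.1 q.2).contDiff
  refine measure_mono_null (Set.image_mono ?_)
    (volume_image_kkt_eq_zero (f := usesL (D := D)) usesL.contDiff hg)
  rintro x ⟨hx, hcrit⟩
  obtain ⟨a, b, ha, hb, ha', hb', hL⟩ := exists_reduced_multipliers T hx hcrit
  obtain ⟨ν, hν, hν', hf⟩ := eq_sum_bits_of_nonneg_on_domain hx.1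
    (f := usesL + a • accuracyL T x + ∑ S, b S • capacityL S.1) (fun z hz => by
      have := hL z hz
      simpa using this) (fun w h1 h2 => by
      have e1 : accuracyL T x w = 0 := by simp [accuracyL_apply, h1]
      have e2 : ∀ S, capacityL S w = 0 := fun S => by
        simp [capacityL_apply, capacityFun, h1, h2]
      have e3 : usesL w = 0 := h2
      simp [e1, e2, e3])
  refine ⟨Sum.elim (fun _ => a) (Sum.elim b ν), ?_, ?_, ?_⟩
  · rintro (_ | S | q)
    exacts [ha, hb S, hν q]
  · rintro (_ | S | q)
    · exact ha'
    · exact hb' S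
    · have : ν q * -bits x q.1 q.2 = 0 := by rw [mul_neg, hν' q, neg_zero]
      exact this
  · have d1 : fderiv ℝ (accuracy T) x = accuracyL T x := (hasFDerivAt_accuracy T x).fderiv
    have d2 : ∀ S, fderiv ℝ (capacityL (D := D) S) x = capacityL S := fun S => (capacityL S).fderiv
    have d3 : ∀ q : (n : D.Ω) × D.Idx n, fderiv ℝ (-⇑(bitsL q.1 q.2)) x = -bitsL q.1 q.2 :=
        fun q => by
      rw [fderiv_neg, (bitsL q.1 q.2).fderiv]
    rw [Fintype.sum_sum_type, Fintype.sum_sum_type]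
    simp only [g, Sum.elim_inl, Sum.elim_inr, Finset.univ_unique, Finset.sum_singleton, d1, d2, d3,
      usesL.fderiv, smul_neg, Finset.sum_neg_distrib, ← hf]
    abel

end CriticalValues

/-! ### One step of the algorithm. -/

section Iterates

variable {ι : Type*} {D : Scenario ι}

/-- The violation of the matrix constraint. -/
noncomputable def violation (T : KLT D) (x : Var D) : ℝ := max 0 (conLin T x (.inl ()) x)

theorem violation_nonneg (T : KLT D) (x : Var D) : 0 ≤ violation T x := le_max_left _ _

theorem le_violation (T : KLT D) (x : Var D) : conLin T x (.inl ()) x ≤ violation T x :=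
  le_max_right _ _

theorem capacityFun_linear_nonpos_of (F : CapacityForm) (S : Finset D.Ω) {x : Var D}
    (hx : 0 < uses x) {a : ℝ} (ha : 0 ≤ a) (h : capacityFun F S x + a ≤ 0) :
    capacityFun .linear S x ≤ 0 := by
  rw [← formScale_mul_capacityFun F S hx]
  exact mul_nonpos_of_nonneg_of_nonpos (formScale_pos F hx).le (by linarith)

variable {T : KLT D} {F : CapacityForm} {μ : ℝ} {β : ℕ → ℝ} {x : ℕ → Var D}

theorem IsMCSCA.mem_domain (hx : IsMCSCA T F μ β x) (t : ℕ) : x t ∈ domain D := by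
  cases t with
  | zero => exact hx.1.1
  | succ t => exact (hx.2 t).1.1.1

/-- The trace and capacity constraints hold at all iterates. -/
theorem IsMCSCA.conLin_nonpos (hx : IsMCSCA T F μ β x) (hμ : 0 < μ) (t : ℕ)
    (i : Unit ⊕ {S : Finset D.Ω // S.Nonempty}) : conLin T (x t) (.inr i) (x t) ≤ 0 := by
  obtain ⟨a, ha, h⟩ : ∃ a : ℝ, 0 ≤ a ∧ con T F (.inr i) (x t) + a ≤ 0 := by
    cases t with
    | zero => exact ⟨0, le_rfl, by simpa using hx.1.2 (.inr i)⟩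
    | succ t =>
      have := (hx.2 t).1.2 (.inr i)
      simp only [conSurr] at this
      exact ⟨_, by positivity, this⟩
  match i with
  | .inl _ =>
    simp only [con, conLin] at h ⊢
    linarith
  | .inr S => exact capacityFun_linear_nonpos_of F S.1 (hx.mem_domain t).2.1 ha h

theorem IsMCSCA.norm_sub_le (hx : IsMCSCA T F μ β x) (hβ : ∀ t, 0 ≤ β t) (t : ℕ) :
    ‖x (t + 1) - x t‖ ≤ β t :=
  (sq_le_sq₀ (norm_nonneg _) (hβ t)).1 (hx.2 t).1.1.2

theorem IsMCSCA.uses_le (hx : IsMCSCA T F μ β x) (hβ : ∀ t, 0 ≤ β t) (t : ℕ) :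
    uses (x (t + 1)) ≤ uses (x t) + β t := by
  have h1 := (abs_le.1 (abs_uses_le (x (t + 1) - x t))).2
  rw [uses_sub] at h1
  linarith [hx.norm_sub_le hβ t]

/-- The violation of the matrix constraint is of second order in the size of the trust region. -/
theorem IsMCSCA.exists_violation_le (hx : IsMCSCA T F μ β x) (hμ : 0 < μ) :
    ∃ C : ℝ, 0 ≤ C ∧ ∀ t, violation T (x (t + 1)) ≤ C * β t ^ 2 := by
  obtain ⟨C, hC0, hC⟩ := exists_abs_minEig_sub_le T
  refine ⟨C, hC0, fun t => max_le (by positivity) ?_⟩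
  have h1 := (abs_le.1 (hC (x t) (x (t + 1)))).1
  have h2 := (hx.2 t).1.2 (.inl ())
  have h3 : C * ‖x (t + 1) - x t‖ ^ 2 ≤ C * β t ^ 2 :=
    mul_le_mul_of_nonneg_left (hx.2 t).1.1.2 hC0
  have h4 : 0 ≤ μ * ‖x (t + 1) - x t‖ ^ 2 := by positivity
  simp only [conSurr, conLin, fisherSurr_self] at h2 ⊢
  linarith

/-- Comparison of the next iterate with a point that satisfies the linearised constraints with
some margin. -/
theorem IsMCSCA.uses_le_of_conLin (hx : IsMCSCA T F μ β x) (hμ : 0 < μ) (t : ℕ)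
    {z : Var D} (hz : z ∈ domain D) (hzx : ‖z - x t‖ ≤ β t)
    (hcon : ∀ i, conLin T (x t) i z + (1 + uses z) * (μ * β t ^ 2) ≤ 0) :
    uses (x (t + 1)) ≤ uses z + μ * β t ^ 2 := by
  have hsq : ‖z - x t‖ ^ 2 ≤ β t ^ 2 := pow_le_pow_left₀ (norm_nonneg _) hzx 2
  have hμsq : μ * ‖z - x t‖ ^ 2 ≤ μ * β t ^ 2 := mul_le_mul_of_nonneg_left hsq hμ.le
  have hW := hz.2.1
  have hnn : 0 ≤ μ * β t ^ 2 := by positivity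
  -- The factor 1 + W covers the proximal term itself and also W times it, as the ratio form
  -- requires.
  have h1 : μ * ‖z - x t‖ ^ 2 ≤ (1 + uses z) * (μ * β t ^ 2) := by nlinarith
  have h2 : uses z * (μ * ‖z - x t‖ ^ 2) ≤ (1 + uses z) * (μ * β t ^ 2) := by nlinarith
  have h3 := (hx.2 t).2 z ⟨⟨hz, hsq⟩, fun i => ?_⟩
  · simp only [objSurr] at h3
    have : 0 ≤ μ * ‖x (t + 1) - x t‖ ^ 2 := by positivity
    linarith
  · have h4 := hcon i
    match i with
    | .inl _ =>
      simp only [conSurr, conLin] at h4 ⊢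
      linarith
    | .inr (.inl _) =>
      simp only [conSurr, con, conLin] at h4 ⊢
      linarith
    | .inr (.inr S) =>
      simp only [conSurr, con, conLin] at h4 ⊢
      rw [capacityFun_add_le_zero_iff F S.1 hW]
      cases F <;> simp only [one_mul] <;> linarith

/-- Descent near a feasible point that is not critical. -/
theorem IsMCSCA.exists_local_descent (hx : IsMCSCA T F μ β x) (hμ : 0 < μ) (hβ : ∀ t, 0 ≤ β t)
    {y : Var D} (hcrit : ¬IsCritical T y) :
    ∃ r > 0, ∃ c > 0, ∃ c' > 0, ∃ b > 0, ∀ t, ‖x t - y‖ < r → β t ≤ b →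
      violation T (x t) ≤ c' * β t → uses (x (t + 1)) ≤ uses (x t) - c * β t := by
  simp only [IsCritical, not_forall, not_exists, not_le] at hcrit
  obtain ⟨z, hz, hzy, hneg⟩ := hcrit
  obtain ⟨c, hc, hc1, hc2⟩ : ∃ c > 0, uses z < uses y - c ∧ ∀ i, conLin T y i z < -c := by
    obtain ⟨m, hm⟩ := Finite.exists_max fun i : Con D => conLin T y i z
    refine ⟨min (uses y - uses z) (-conLin T y m z) / 2, ?_, ?_, fun i => ?_⟩
    · have := lt_min (sub_pos.2 hzy) (neg_pos.2 (hneg m))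
      linarith
    · have h1 := min_le_left (uses y - uses z) (-conLin T y m z)
      have h2 := lt_min (sub_pos.2 hzy) (neg_pos.2 (hneg m))
      linarith
    · have h1 := min_le_right (uses y - uses z) (-conLin T y m z)
      have h2 := lt_min (sub_pos.2 hzy) (neg_pos.2 (hneg m))
      have h3 := hm i
      linarith
  have hev : ∀ᶠ w in 𝓝 y, uses z < uses w - c ∧ ∀ i, conLin T w i z < -c := by
    refine (continuousAt_const.eventually_lt
      (continuous_uses.sub continuous_const).continuousAt hc1).and ?_
    exact eventually_all.2 fun i => (continuous_conLin_left T z i).continuousAt.eventually_lt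
      continuousAt_const (hc2 i)
  obtain ⟨r, hr, hball⟩ := Metric.eventually_nhds_iff.1 hev
  -- R bounds ‖z - x t‖ on the ball, so moving the fraction β/R towards z stays in the trust region;
  -- R ≥ 1 and β ≤ 1 keep the fraction at most 1.
  set R : ℝ := 1 + ‖z - y‖ + r with hR
  have hR1 : 1 ≤ R := by
    have := norm_nonneg (z - y)
    linarith
  have hRp : 0 < R := by linarith
  set Wmax : ℝ := 1 + (uses y + r) with hWmax
  have hyp : 0 < uses y := hz.2.1.trans hzy
  have hWp : 1 ≤ Wmax := by linarith
  -- The step towards z gains (c/R)β in the objective and in the constraints. Half of the constraint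
  -- gain pays for the present violation, the other half for the proximal terms, which are O(β²).
  refine ⟨r, hr, c / R / 2, by positivity, c / R / 2, by positivity,
    min 1 (c / R / 2 / (Wmax * μ)), by positivity, fun t ht hb hv => ?_⟩
  obtain ⟨hu, hcl⟩ := hball (by rwa [dist_eq_norm] : dist (x t) y < r)
  have hβt := hβ t
  have hb1 : β t ≤ 1 := hb.trans (min_le_left _ _)
  have hb2 : Wmax * μ * β t ≤ c / R / 2 := by
    have := hb.trans (min_le_right _ _)
    rwa [le_div_iff₀ (by positivity), mul_comm] at this
  set s := β t / R with hs
  have hs0 : 0 ≤ s := by positivity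
  have hs1 : s ≤ 1 := by
    rw [hs, div_le_one hRp]
    linarith
  have hsc : s * c = c / R * β t := by rw [hs]; ring
  set w := (1 - s) • x t + s • z with hw
  have hwdom : w ∈ domain D :=
    convex_domain (hx.mem_domain t) hz (by linarith) hs0 (by ring)
  have hwx : ‖w - x t‖ ≤ β t := by
    have e : w - x t = s • (z - x t) := by rw [hw]; module
    rw [e, norm_smul, Real.norm_eq_abs, abs_of_nonneg hs0]
    have h1 : ‖z - x t‖ ≤ R := by
      have h1 : z - x t = (z - y) - (x t - y) := by abel
      rw [h1]
      have := _root_.norm_sub_le (z - y) (x t - y)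
      linarith
    calc s * ‖z - x t‖ ≤ s * R := mul_le_mul_of_nonneg_left h1 hs0
      _ = β t := div_mul_cancel₀ _ hRp.ne'
  have husesw : uses w ≤ uses (x t) - c / R * β t := by
    rw [hw, uses_add, uses_smul, uses_smul, ← hsc]
    nlinarith
  have hxt : uses (x t) ≤ uses y + r := by
    have h1 := (abs_le.1 (abs_uses_le (x t - y))).2
    rw [uses_sub] at h1
    linarith
  have hcRβ : 0 ≤ c / R * β t := by positivity
  have hquad : Wmax * (μ * β t ^ 2) ≤ c / R / 2 * β t := by
    calc Wmax * (μ * β t ^ 2) = Wmax * μ * β t * β t := by ring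
      _ ≤ c / R / 2 * β t := mul_le_mul_of_nonneg_right hb2 hβt
  have hμβ : 0 ≤ μ * β t ^ 2 := by positivity
  have hfin := hx.uses_le_of_conLin hμ t hwdom hwx fun i => ?_
  · have : μ * β t ^ 2 ≤ Wmax * (μ * β t ^ 2) := le_mul_of_one_le_left hμβ hWp
    linarith
  · have h1 : (1 + uses w) * (μ * β t ^ 2) ≤ c / R / 2 * β t := by
      refine le_trans (mul_le_mul_of_nonneg_right ?_ hμβ) hquad
      linarith
    have h2 := conLin_combination_le T (x t) (x t) z (sub_nonneg.2 hs1) hs0 (by ring) i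
    have h3 : s * conLin T (x t) i z ≤ -(c / R * β t) := by
      rw [← hsc, ← mul_neg]
      exact mul_le_mul_of_nonneg_left (hcl i).le hs0
    have h4 : (1 - s) * conLin T (x t) i (x t) ≤ c / R / 2 * β t := by
      match i with
      | .inl _ =>
        have h5 : (1 - s) * conLin T (x t) (.inl ()) (x t) ≤ (1 - s) * violation T (x t) :=
          mul_le_mul_of_nonneg_left (le_violation T _) (sub_nonneg.2 hs1)
        have h6 : (1 - s) * violation T (x t) ≤ violation T (x t) :=
          mul_le_of_le_one_left (violation_nonneg T _) (by linarith)
        exact h5.trans (h6.trans hv)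
      | .inr i =>
        have h5 := mul_nonpos_of_nonneg_of_nonpos (sub_nonneg.2 hs1) (hx.conLin_nonpos hμ t i)
        linarith
    linarith

end Iterates

/-! ### Limits and bounds for nearly feasible points. -/

section Compactness

variable {ι : Type*} {D : Scenario ι}

/-- A limit of nearly feasible points is feasible. -/
theorem linFeasible_of_tendsto (T : KLT D) {y : ℕ → Var D} {x : Var D}
    (hy : ∀ k, y k ∈ domain D) (hcon : ∀ k i, conLin T (y k) (.inr i) (y k) ≤ 0)
    (hviol : Tendsto (fun k => violation T (y k)) atTop (𝓝 0)) (hlim : Tendsto y atTop (𝓝 x))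
    (hW : 0 < uses x) : LinFeasible T x := by
  refine ⟨⟨fun n j => ?_, hW, ?_⟩, ?_⟩
  · exact ge_of_tendsto' (((continuous_bits n j).tendsto x).comp hlim) fun k => (hy k).1 n j
  · have h1 := (continuous_aux.tendsto x).comp hlim
    have h2 := (continuous_aux.matrix_transpose.tendsto x).comp hlim
    exact tendsto_nhds_unique h2 (h1.congr fun k => (hy k).2.2.symm)
  · rintro (u | i)
    · exact le_of_tendsto_of_tendsto' (((continuous_conLin_self T (.inl ())).tendsto x).comp hlim)
        hviol fun k => le_violation T (y k)
    · exact le_of_tendsto' (((continuous_conLin_self T (.inr i)).tendsto x).comp hlim)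
        fun k => hcon k i

theorem norm_le_of_forall_abs_le {κ : Type*} [Fintype κ] {x : EuclideanSpace ℝ κ} {K : ℝ}
    (h : ∀ c, |x c| ≤ K) : ‖x‖ ≤ Real.sqrt (∑ _c : κ, K ^ 2) := by
  rw [EuclideanSpace.norm_eq]
  refine Real.sqrt_le_sqrt (Finset.sum_le_sum fun c _ => ?_)
  exact pow_le_pow_left₀ (norm_nonneg _) (h c) 2

/-- Nearly feasible points with a bounded objective are bounded. -/
theorem exists_norm_le_of_uses_le (T : KLT D) {B : ℝ} (hB : 0 ≤ B) : ∃ R : ℝ, ∀ x : Var D,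
    x ∈ domain D → (∀ i, conLin T x (.inr i) x ≤ 0) → violation T x ≤ 1 → uses x ≤ B →
      ‖x‖ ≤ R := by
  let C : ℝ := ∑ n : D.Ω, capacity D {n}
  have hCn : ∀ n : D.Ω, 0 < capacity D {n} := fun n => capacity_pos (Finset.singleton_nonempty n)
  have hC : ∀ n : D.Ω, capacity D {n} ≤ C := fun n =>
    Finset.single_le_sum (f := fun n : D.Ω => capacity D {n}) (fun n _ => (hCn n).le)
      (Finset.mem_univ n)
  have hC0 : 0 ≤ C := Finset.sum_nonneg fun n _ => (hCn n).le
  refine ⟨_, fun x hx hcon hviol huses => norm_le_of_forall_abs_le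
    (K := B * C + B + (|D.ε| + 2)) fun c => ?_⟩
  have hBC := mul_nonneg hB hC0
  have hε := abs_nonneg D.ε
  match c with
  | .inl ⟨n, j⟩ =>
    have h0 := hx.1 n j
    have h1 := hcon (.inr ⟨{n}, Finset.singleton_nonempty n⟩)
    simp only [conLin, capacityFun, Finset.sum_singleton] at h1
    have h2 : bits x n j ≤ ∑ j, bits x n j :=
      Finset.single_le_sum (f := fun j => bits x n j) (fun j _ => hx.1 n j) (Finset.mem_univ j)
    have h3 : uses x * capacity D {n} ≤ B * C :=
      mul_le_mul huses (hC n) (hCn n).le hB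
    change |bits x n j| ≤ _
    rw [abs_of_nonneg h0]
    linarith
  | .inr (.inl u) =>
    change |uses x| ≤ _
    rw [abs_of_pos hx.2.1]
    linarith
  | .inr (.inr (i, k)) =>
    have h1 := (le_violation T x).trans hviol
    simp only [conLin, fisherSurr_self] at h1
    rw [neg_le] at h1
    -- Violation at most 1 means λ_min(G) ≥ -1, hence M ≥ -I; with tr M ≤ ε this bounds every entry
    -- of M.
    have hq : ∀ u : Fin 2 → ℝ, -1 * (u 0 ^ 2 + u 1 ^ 2) ≤
        aux x 0 0 * u 0 ^ 2 + (aux x 0 1 + aux x 1 0) * (u 0 * u 1) + aux x 1 1 * u 1 ^ 2 := by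
      intro u
      have h2 := le_minEig_iff.1 h1 (Sum.elim u 0)
      rw [dotProduct_blockMat_mulVec] at h2
      simp [dotProduct, Fin.sum_univ_two, ← pow_two] at h2
      linarith
    have htr := hcon (.inl ())
    simp only [conLin, Matrix.trace_fin_two] at htr
    have hsymm : aux x 1 0 = aux x 0 1 := hx.2.2.apply 0 1
    have q1 := hq ![1, 0]
    have q2 := hq ![0, 1]
    have q3 := hq ![1, 1]
    have q4 := hq ![1, -1]
    simp [hsymm] at q1 q2 q3 q4
    have hle := le_abs_self D.ε
    change |aux x i k| ≤ _
    rw [abs_le]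
    fin_cases i <;> fin_cases k <;> simp only [Fin.zero_eta, Fin.mk_one, Fin.isValue, hsymm] <;>
      constructor <;> linarith

end Compactness

/-! ### Merit function, level crossing and the limit point. -/

section Convergence

open MeasureTheory

/-- One step of the merit function `W + κ v`. -/
theorem merit_step {W W' v v' b c c' C : ℝ} (hc : 0 < c) (hc' : 0 < c') (hb : 0 ≤ b)
    (hv : 0 ≤ v) (hv' : v' ≤ C * b ^ 2) (hW' : W' ≤ W + b) (hd : v ≤ c' * b → W' ≤ W - c * b)
    (hs : (1 + c) / c' * C * b ≤ c / 2) :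
    W' + (1 + c) / c' * v' ≤ W + (1 + c) / c' * v - c / 2 * b := by
  have hκ : 0 < (1 + c) / c' := by positivity
  have h1 : (1 + c) / c' * v' ≤ c / 2 * b :=
    calc (1 + c) / c' * v' ≤ (1 + c) / c' * (C * b ^ 2) := mul_le_mul_of_nonneg_left hv' hκ.le
      _ = (1 + c) / c' * C * b * b := by ring
      _ ≤ c / 2 * b := mul_le_mul_of_nonneg_right hs hb
  by_cases h : v ≤ c' * b
  · have := hd h
    have := mul_nonneg hκ.le hv
    linarith
  -- The weight is chosen for this case: the old violation carries merit above (1 + c)b, enough for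
  -- a rise of W by b and a net loss of cb.
  · have h2 : (1 + c) / c' * (c' * b) ≤ (1 + c) / c' * v :=
      mul_le_mul_of_nonneg_left (not_le.1 h).le hκ.le
    have h3 : (1 + c) / c' * (c' * b) = b + c * b := by field_simp
    linarith

/-- A sequence with divergent total step bound that decreases a nonnegative merit function in
proportion to the step bound inside a ball leaves the ball, with a definite decrease. -/
theorem exists_merit_decrease {E : Type*} [SeminormedAddCommGroup E] {x : ℕ → E} {y : E}
    {β Φ : ℕ → ℝ} {r c : ℝ} {t₀ : ℕ} (hc : 0 < c)
    (hβ_sum : Tendsto (fun m => ∑ t ∈ Finset.range m, β t) atTop atTop)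
    (hstep : ∀ t, ‖x (t + 1) - x t‖ ≤ β t) (hΦ : ∀ t, 0 ≤ Φ t) (h₀ : ‖x t₀ - y‖ < r / 2)
    (hdec : ∀ t ≥ t₀, ‖x t - y‖ < r → Φ (t + 1) ≤ Φ t - c * β t) :
    ∃ t ≥ t₀, Φ t ≤ Φ t₀ - c * (r / 2) := by
  have hind : ∀ k, (∀ j < k, ‖x (t₀ + j) - y‖ < r) →
      Φ (t₀ + k) ≤ Φ t₀ - c * ∑ j ∈ Finset.range k, β (t₀ + j) ∧
      ‖x (t₀ + k) - x t₀‖ ≤ ∑ j ∈ Finset.range k, β (t₀ + j) := by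
    intro k
    induction k with
    | zero => intro _; simp
    | succ k ih =>
      intro hk
      obtain ⟨h1, h2⟩ := ih fun j hj => hk j (by omega)
      rw [Finset.sum_range_succ, ← add_assoc]
      constructor
      · have := hdec (t₀ + k) (by omega) (hk k (by omega))
        linarith
      · have e : x (t₀ + k + 1) - x t₀ = (x (t₀ + k + 1) - x (t₀ + k)) + (x (t₀ + k) - x t₀) := by
          abel
        rw [e]
        have := norm_add_le (x (t₀ + k + 1) - x (t₀ + k)) (x (t₀ + k) - x t₀)
        linarith [hstep (t₀ + k)]
  -- Staying in the ball for ever would make Φ negative, since the step bounds have infinite sum.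
  have hexit : ∃ k, r ≤ ‖x (t₀ + k) - y‖ := by
    by_contra! hcon
    obtain ⟨m, hm, hm'⟩ := ((tendsto_atTop.1 hβ_sum
      (Φ t₀ / c + ∑ t ∈ Finset.range t₀, β t + 1)).and (eventually_ge_atTop t₀)).exists
    obtain ⟨k, rfl⟩ := Nat.exists_eq_add_of_le hm'
    have h1 := (hind k fun j _ => hcon j).1
    rw [Finset.sum_range_add] at hm
    have h2 : c * (Φ t₀ / c + 1) ≤ c * ∑ j ∈ Finset.range k, β (t₀ + j) :=
      mul_le_mul_of_nonneg_left (by linarith) hc.le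
    rw [mul_add, mul_div_cancel₀ _ hc.ne'] at h2
    linarith [hΦ (t₀ + k)]
  classical
  -- Up to the first exit the path covers at least r/2, so the step bounds sum to at least r/2.
  refine ⟨t₀ + Nat.find hexit, by omega, ?_⟩
  obtain ⟨h1, h2⟩ := hind (Nat.find hexit) fun j hj => not_le.1 (Nat.find_min hexit hj)
  have h3 := Nat.find_spec hexit
  have h4 : r / 2 ≤ ‖x (t₀ + Nat.find hexit) - x t₀‖ := by
    have e : x (t₀ + Nat.find hexit) - y = (x (t₀ + Nat.find hexit) - x t₀) + (x t₀ - y) := by abel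
    rw [e] at h3
    have := norm_add_le (x (t₀ + Nat.find hexit) - x t₀) (x t₀ - y)
    linarith
  have := mul_le_mul_of_nonneg_left (h4.trans h2) hc.le
  linarith

variable {ι : Type*} {D : Scenario ι} {T : KLT D} {F : CapacityForm} {μ : ℝ} {β : ℕ → ℝ}
  {x : ℕ → Var D}

theorem IsMCSCA.tendsto_violation (hx : IsMCSCA T F μ β x) (hμ : 0 < μ)
    (hβ_lim : Tendsto β atTop (𝓝 0)) : Tendsto (fun t => violation T (x t)) atTop (𝓝 0) := by
  obtain ⟨C, -, hC⟩ := hx.exists_violation_le hμ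
  rw [← tendsto_add_atTop_iff_nat 1]
  refine squeeze_zero (fun t => violation_nonneg T _) hC ?_
  simpa using (hβ_lim.pow 2).const_mul C

/-- Uniform descent around a level without critical points. -/
theorem IsMCSCA.exists_level_descent (hx : IsMCSCA T F μ β x) (hμ : 0 < μ) (hβ : ∀ t, 0 ≤ β t)
    (hβ_lim : Tendsto β atTop (𝓝 0)) {w : ℝ} (hw : 0 < w)
    (hcrit : ∀ y, LinFeasible T y → uses y = w → ¬IsCritical T y) :
    ∃ η > 0, ∃ c > 0, ∃ c' > 0, ∃ N, ∀ t ≥ N, |uses (x t) - w| < η →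
      violation T (x t) ≤ c' * β t → uses (x (t + 1)) ≤ uses (x t) - c * β t := by
  -- Counterexamples with all constants 1/(m + 1) accumulate at a feasible y of level w, which is
  -- not critical; local descent there contradicts them.
  by_contra! hcon
  have hpos : ∀ m : ℕ, (0 : ℝ) < 1 / (m + 1) := fun m => Nat.one_div_pos_of_nat
  have hzero : Tendsto (fun m : ℕ => 1 / ((m : ℝ) + 1)) atTop (𝓝 0) :=
    tendsto_one_div_add_atTop_nhds_zero_nat
  choose s hs hs1 hs2 hs3 using fun m : ℕ => hcon _ (hpos m) _ (hpos m) _ (hpos m) m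
  have hs_lim : Tendsto s atTop atTop := tendsto_atTop_mono hs tendsto_id
  have hviol := (hx.tendsto_violation hμ hβ_lim).comp hs_lim
  obtain ⟨R, hR⟩ := exists_norm_le_of_uses_le T (B := w + 1) (by linarith)
  have hbdd : ∃ᶠ m in atTop, x (s m) ∈ Metric.closedBall (0 : Var D) R := by
    refine Eventually.frequently ?_
    filter_upwards [hviol.eventually_le_const one_pos] with m hm
    rw [mem_closedBall_zero_iff]
    refine hR _ (hx.mem_domain _) (hx.conLin_nonpos hμ _) hm ?_
    have h1 := (abs_lt.1 (hs1 m)).2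
    have h2 : 1 / ((m : ℝ) + 1) ≤ 1 := by
      rw [div_le_one (by positivity)]
      linarith [(Nat.cast_nonneg m : (0 : ℝ) ≤ m)]
    linarith
  obtain ⟨y, -, ψ, hψ, hy⟩ := tendsto_subseq_of_frequently_bounded Metric.isBounded_closedBall hbdd
  have huses : uses y = w := by
    have h1 := (continuous_uses.tendsto y).comp hy
    have h2 : Tendsto (fun m => uses (x (s m))) atTop (𝓝 w) := by
      rw [tendsto_iff_norm_sub_tendsto_zero]
      exact squeeze_zero (fun m => norm_nonneg _) (fun m => (hs1 m).le) hzero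
    exact tendsto_nhds_unique h1 (h2.comp hψ.tendsto_atTop)
  have hfeas : LinFeasible T y := linFeasible_of_tendsto T (fun k => hx.mem_domain (s (ψ k)))
    (fun k => hx.conLin_nonpos hμ (s (ψ k))) (hviol.comp hψ.tendsto_atTop) hy (huses ▸ hw)
  obtain ⟨r, hr, c, hc, c', hc', b, hb, hloc⟩ :=
    hx.exists_local_descent hμ hβ (hcrit y hfeas huses)
  have hz := hzero.comp hψ.tendsto_atTop
  obtain ⟨k, hk1, hk2, hk3, hk4⟩ := ((hy.eventually (Metric.ball_mem_nhds y hr)).and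
    (((hβ_lim.comp (hs_lim.comp hψ.tendsto_atTop)).eventually_le_const hb).and
    ((hz.eventually_le_const hc').and (hz.eventually_le_const hc)))).exists
  have hβk := hβ (s (ψ k))
  have h1 := hloc (s (ψ k)) (by simpa [dist_eq_norm] using hk1) hk2
    ((hs2 (ψ k)).trans (mul_le_mul_of_nonneg_right hk3 hβk))
  have h2 := hs3 (ψ k)
  have h3 := mul_le_mul_of_nonneg_right hk4 hβk
  simp only [Function.comp_apply] at h3
  linarith

/-- A level without critical points is eventually not crossed upwards. -/
theorem IsMCSCA.exists_uses_le_of_level (hx : IsMCSCA T F μ β x) (hμ : 0 < μ)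
    (hβ : ∀ t, 0 ≤ β t) (hβ_lim : Tendsto β atTop (𝓝 0)) {w w' : ℝ} (hw : 0 < w) (hw' : w' < w)
    (hcrit : ∀ y, LinFeasible T y → uses y = w → ¬IsCritical T y) :
    ∃ N, ∀ s ≥ N, uses (x s) ≤ w' → ∀ t ≥ s, uses (x t) ≤ w := by
  obtain ⟨η, hη, c, hc, c', hc', N, hN⟩ := hx.exists_level_descent hμ hβ hβ_lim hw hcrit
  obtain ⟨C, hC0, hC⟩ := hx.exists_violation_le hμ
  set κ := (1 + c) / c' with hκdef
  have hκ : 0 < κ := by positivity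
  have hviol := hx.tendsto_violation hμ hβ_lim
  have l1 : ∀ᶠ t in atTop, κ * C * β t ≤ c / 2 :=
    Tendsto.eventually_le_const (half_pos hc) (by simpa using hβ_lim.const_mul (κ * C))
  have l2 : ∀ᶠ t in atTop, β t + κ * (C * β t ^ 2) ≤ η :=
    Tendsto.eventually_le_const hη
      (by simpa using hβ_lim.add (((hβ_lim.pow 2).const_mul C).const_mul κ))
  have l3 : ∀ᶠ t in atTop, κ * violation T (x t) ≤ w - w' :=
    Tendsto.eventually_le_const (sub_pos.2 hw') (by simpa using hviol.const_mul κ)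
  obtain ⟨N', hN'⟩ := eventually_atTop.1 (l1.and (l2.and l3))
  refine ⟨max N N', fun s hs hsw => ?_⟩
  -- Near the level the merit does not increase; from W ≤ w - η one step is too short to bring it
  -- above w. The gap w - w' absorbs the initial violation.
  have hmerit : ∀ t ≥ s, uses (x t) + κ * violation T (x t) ≤ w := by
    intro t ht
    induction t, ht using Nat.le_induction with
    | base => linarith [(hN' s (le_of_max_le_right hs)).2.2]
    | succ t ht ih =>
      have htN : N ≤ t := (le_of_max_le_left hs).trans ht
      obtain ⟨k1, k2, -⟩ := hN' t ((le_of_max_le_right hs).trans ht)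
      have hβt := hβ t
      have hv := mul_nonneg hκ.le (violation_nonneg T (x t))
      by_cases hlev : |uses (x t) - w| < η
      · have := merit_step hc hc' hβt (violation_nonneg T (x t)) (hC t) (hx.uses_le hβ t)
          (hN t htN hlev) k1
        have h2 : 0 ≤ c / 2 * β t := by positivity
        linarith
      · have h1 : uses (x t) ≤ w - η := by
          rcases le_abs.1 (not_lt.1 hlev) with h | h <;> linarith
        have h2 := mul_le_mul_of_nonneg_left (hC t) hκ.le
        have h3 := hx.uses_le hβ t
        linarith
  intro t ht
  have := hmerit t ht
  have := mul_nonneg hκ.le (violation_nonneg T (x t))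
  linarith

/-- Every limit point in the domain is critical. -/
theorem IsMCSCA.isCritical_of_tendsto (hx : IsMCSCA T F μ β x) (hμ : 0 < μ)
    (hβ : ∀ t, 0 ≤ β t) (hβ_lim : Tendsto β atTop (𝓝 0))
    (hβ_sum : Tendsto (fun m => ∑ t ∈ Finset.range m, β t) atTop atTop)
    {y : Var D} (hy : 0 < uses y) {φ : ℕ → ℕ} (hφ : StrictMono φ)
    (hlim : Tendsto (fun k => x (φ k)) atTop (𝓝 y)) : IsCritical T y := by
  by_contra hncrit
  obtain ⟨r, hr, c, hc, c', hc', b, hb, hloc⟩ := hx.exists_local_descent hμ hβ hncrit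
  obtain ⟨C, hC0, hC⟩ := hx.exists_violation_le hμ
  set κ := (1 + c) / c' with hκdef
  have hκ : 0 < κ := by positivity
  have hviol := hx.tendsto_violation hμ hβ_lim
  have l1 : ∀ᶠ t in atTop, κ * C * β t ≤ c / 2 :=
    Tendsto.eventually_le_const (half_pos hc) (by simpa using hβ_lim.const_mul (κ * C))
  obtain ⟨N, hN⟩ := eventually_atTop.1 (l1.and (hβ_lim.eventually_le_const hb))
  set Φ : ℕ → ℝ := fun t => uses (x t) + κ * violation T (x t) with hΦ
  have hΦ0 : ∀ t, 0 ≤ Φ t := fun t =>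
    add_nonneg (hx.mem_domain t).2.1.le (mul_nonneg hκ.le (violation_nonneg T _))
  have hdec : ∀ t ≥ N, ‖x t - y‖ < r → Φ (t + 1) ≤ Φ t - c / 2 * β t := fun t ht hball =>
    merit_step hc hc' (hβ t) (violation_nonneg T (x t)) (hC t) (hx.uses_le hβ t)
      (hloc t hball (hN t ht).2) (hN t ht).1
  have hulim : Tendsto (fun k => uses (x (φ k))) atTop (𝓝 (uses y)) :=
    (continuous_uses.tendsto y).comp hlim
  have hΦlim : Tendsto (fun k => Φ (φ k)) atTop (𝓝 (uses y)) := by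
    simpa using hulim.add ((hviol.comp hφ.tendsto_atTop).const_mul κ)
  set δ := c / 2 * (r / 2) with hδ
  have hδ0 : 0 < δ := by positivity
  -- An interval has positive measure, so it contains a noncritical level. An excursion starting
  -- with merit below W(y) + δ/2 loses δ and ends below w, whereas W along the subsequence returns
  -- to W(y) > w.
  obtain ⟨w, ⟨hw1, hw2⟩, hw3⟩ : ∃ w ∈ Set.Ioo (max 0 (uses y - δ / 2)) (uses y),
      w ∉ uses '' {z : Var D | LinFeasible T z ∧ IsCritical T z} := by
    by_contra! hcon
    have h1 := measure_mono_null hcon (volume_criticalValues_eq_zero T)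
    rw [Real.volume_Ioo, ENNReal.ofReal_eq_zero, sub_nonpos, le_max_iff] at h1
    rcases h1 with h | h <;> linarith
  obtain ⟨N', hN'⟩ := hx.exists_uses_le_of_level hμ hβ hβ_lim ((le_max_left _ _).trans_lt hw1)
    ((le_max_right _ _).trans_lt hw1) fun z hz hzw hzc => hw3 ⟨z, ⟨hz, hzc⟩, hzw⟩
  have hball : ∀ᶠ k in atTop, ‖x (φ k) - y‖ < r / 2 := by
    have := tendsto_iff_norm_sub_tendsto_zero.1 hlim
    exact this.eventually_lt_const (half_pos hr)
  obtain ⟨k, hk1, hk2, hk3⟩ := (hball.and ((hΦlim.eventually_lt_const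
    (lt_add_of_pos_right (uses y) (half_pos hδ0))).and
    (hφ.tendsto_atTop.eventually_ge_atTop (max N N')))).exists
  obtain ⟨t, ht, hΦt⟩ := exists_merit_decrease (half_pos hc) hβ_sum (hx.norm_sub_le hβ) hΦ0 hk1
    fun t ht => hdec t ((le_of_max_le_left hk3).trans ht)
  have hut : uses (x t) ≤ uses y - δ / 2 := by
    have := mul_nonneg hκ.le (violation_nonneg T (x t))
    have h1 : Φ t = uses (x t) + κ * violation T (x t) := rfl
    linarith
  have hall := hN' t ((le_of_max_le_right hk3).trans ht) hut
  obtain ⟨m, hm1, hm2⟩ := ((hulim.eventually_const_lt hw2).and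
    (hφ.tendsto_atTop.eventually_ge_atTop t)).exists
  exact absurd (hall _ hm2) (not_le.2 hm1)

/-- Slater's condition yields a point at which the constraints linearised at the limit are
negative. -/
theorem Slater.exists_conLin_neg (hμ : 0 < μ) {y : Var D} {φ : ℕ → ℕ}
    (hlim : Tendsto (fun k => x (φ k)) atTop (𝓝 y)) (hs : Slater T F μ x φ) :
    ∃ z ∈ domain D, ∀ i, conLin T y i z < 0 := by
  obtain ⟨flim, hconv, z, hz, hneg⟩ := hs
  have hzd : z ∈ domain D := intrinsicInterior_subset hz
  refine ⟨z, hzd, fun i => ?_⟩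
  have hsq : Tendsto (fun k => μ * ‖z - x (φ k)‖ ^ 2) atTop (𝓝 (μ * ‖z - y‖ ^ 2)) :=
    ((tendsto_const_nhds.sub hlim).norm.pow 2).const_mul μ
  -- The limiting surrogates exceed the constraints linearised at y (the true capacity constraints,
  -- in the form F) by this term, so dropping it keeps them negative.
  have hnn : 0 ≤ μ * ‖z - y‖ ^ 2 := by positivity
  have hi := hneg i
  match i with
  | .inl u =>
    have h1 := ((continuous_conLin_left T z (.inl u)).tendsto y).comp hlim
    have h2 := tendsto_nhds_unique (hconv (.inl u) z hzd) (h1.add hsq)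
    linarith
  | .inr j =>
    have h2 : flim (.inr j) z = con T F (.inr j) z + μ * ‖z - y‖ ^ 2 :=
      tendsto_nhds_unique (hconv (.inr j) z hzd) (hsq.const_add _)
    have h3 : con T F (.inr j) z < 0 := by linarith
    match j with
    | .inl _ => exact h3
    | .inr S =>
      have h4 : capacityFun F S.1 z < 0 := h3
      simp only [conLin]
      rw [← formScale_mul_capacityFun F S.1 hzd.2.1]
      exact mul_neg_of_pos_of_neg (formScale_pos F hzd.2.1) h4

end Convergence

end MCSCA

theorem theorem1 {ι : Type*} (D : MCSCA.Scenario ι) (T : MCSCA.KLT D) (F : MCSCA.CapacityForm)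
    (μ : ℝ) (hμ : 0 < μ)
    (β : ℕ → ℝ) (hβ_anti : Antitone β) (hβ_lim : Tendsto β atTop (𝓝 0))
    (hβ_sum : Tendsto (fun m => ∑ t ∈ Finset.range m, β t) atTop atTop)
    (x : ℕ → MCSCA.Var D) (hx : MCSCA.IsMCSCA T F μ β x)
    (xstar : MCSCA.Var D) (hdom : xstar ∈ MCSCA.domain D)
    (φ : ℕ → ℕ) (hφ : StrictMono φ) (hlim : Tendsto (fun k => x (φ k)) atTop (𝓝 xstar))
    (hslater : MCSCA.Slater T F μ x φ) :
    MCSCA.IsKKT (MCSCA.domain D) MCSCA.uses (MCSCA.con T F) xstar := by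
  have hβ : ∀ t, 0 ≤ β t := hβ_anti.le_of_tendsto hβ_lim
  have hW : 0 < MCSCA.uses xstar := hdom.2.1
  have hfeas : MCSCA.LinFeasible T xstar := MCSCA.linFeasible_of_tendsto T
    (fun k => hx.mem_domain (φ k)) (fun k => hx.conLin_nonpos hμ (φ k))
    ((hx.tendsto_violation hμ hβ_lim).comp hφ.tendsto_atTop) hlim hW
  obtain ⟨z, hz, hneg⟩ := hslater.exists_conLin_neg hμ hlim
  exact MCSCA.isKKT_of_isCritical T F hfeas
    (hx.isCritical_of_tendsto hμ hβ hβ_lim hβ_sum hW hφ hlim) hz hneg
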